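/- Let $(X,Y)$ be a bivariate normal random vector with mean $(\mu_X,\mu_Y)\in\mathbb{R}^2$, variances $(\sigma_X^2,\sigma_Y^2)$ with $\sigma_X,\sigma_Y>0$, and correlation coefficient $\rho\in(-1,1)$. Let $n\ge 1$, let $Z_1,\dots,Z_n$ be independent copies of the product $Z=XY$, and let $S_n=\sum_{i=1}^n Z_i$. For $\nu\in\mathbb{R}$ and $z>0$ let $I_\nu(z)=\sum_{k=0}^\infty \frac{(z/2)^{2k+\nu}}{k!\,\Gamma(k+\nu+1)}$ be the modified Bessel function of the first kind. Then $S_n$ has a probability density function $f_{S_n}$ that is continuous on $\mathbb{R}\setminus\{0\}$ and is given by the following formulas, in which all integrals converge absolutely. 1. Suppose $|\mu_X|/\sigma_X\neq|\mu_Y|/\sigma_Y$. Then, for $x>0$, $$f_{S_n}(x)=D_1(x)\int_0^\infty (t(t+1))^{(n-2)/4}\exp\Big(-\frac{2xt}{\sigma_X\sigma_Y(1-\rho^2)}\Big) I_{\frac n2-1}\Big(\Big|\frac{\mu_X}{\sigma_X}-\frac{\mu_Y}{\sigma_Y}\Big|\frac{\sqrt{nxt}}{(1-\rho)\sqrt{\sigma_X\sigma_Y}}\Big)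 I_{\frac n2-1}\Big(\Big|\frac{\mu_X}{\sigma_X}+\frac{\mu_Y}{\sigma_Y}\Big|\frac{\sqrt{nx(1+t)}}{(1+\rho)\sqrt{\sigma_X\sigma_Y}}\Big)\,dt,$$ where $$D_1(x)=\frac{1}{\sigma_X\sigma_Y(1-\rho^2)}\Big(\frac n4\Big)^{1-n/2}\Big|\frac{\mu_X^2}{\sigma_X^2}-\frac{\mu_Y^2}{\sigma_Y^2}\Big|^{1-n/2}\Big(\frac{x}{\sigma_X\sigma_Y}\Big)^{n/2}\exp\Big(-\frac{n}{2(1-\rho^2)}\Big(\frac{\mu_X^2}{\sigma_X^2}+\frac{\mu_Y^2}{\sigma_Y^2}-\frac{2\rho\mu_X\mu_Y}{\sigma_X\sigma_Y}\Big)-\frac{x}{\sigma_X\sigma_Y(1+\rho)}\Big).$$ 2. Suppose $\mu_X/\sigma_X=\mu_Y/\sigma_Y$. Then, for $x>0$, $$f_{S_n}(x)=D_2(x)\int_0^\infty (t^2(t+1))^{(n-2)/4}\exp\Big(-\frac{2xt}{\sigma_X\sigma_Y(1-\rho^2)}\Big) I_{\frac n2-1}\Big(\frac{2|\mu_X|}{\sigma_X}\frac{\sqrt{nx(1+t)}}{(1+\rho)\sqrt{\sigma_X\sigma_Y}}\Big)\,dt,$$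 where $$D_2(x)=\frac{n^{(2-n)/4}}{\sigma_X\sigma_Y(1-\rho)^{n/2}(1+\rho)\Gamma(n/2)}\Big(\frac{|\mu_X|}{\sigma_X}\Big)^{1-n/2}\Big(\frac{x}{\sigma_X\sigma_Y}\Big)^{(3n-2)/4}\exp\Big(-\frac{n\mu_X^2}{\sigma_X^2(1+\rho)}-\frac{x}{\sigma_X\sigma_Y(1+\rho)}\Big).$$ 3. Suppose $\mu_X/\sigma_X=-\mu_Y/\sigma_Y$. Then, for $x>0$, $$f_{S_n}(x)=D_3(x)\int_0^\infty ((t+1)^2t)^{(n-2)/4}\exp\Big(-\frac{2xt}{\sigma_X\sigma_Y(1-\rho^2)}\Big) I_{\frac n2-1}\Big(\frac{2|\mu_X|}{\sigma_X}\frac{\sqrt{nxt}}{(1-\rho)\sqrt{\sigma_X\sigma_Y}}\Big)\,dt,$$ where $$D_3(x)=\frac{n^{(2-n)/4}}{\sigma_X\sigma_Y(1+\rho)^{n/2}(1-\rho)\Gamma(n/2)}\Big(\frac{|\mu_X|}{\sigma_X}\Big)^{1-n/2}\Big(\frac{x}{\sigma_X\sigma_Y}\Big)^{(3n-2)/4}\exp\Big(-\frac{n\mu_X^2}{\sigma_X^2(1-\rho)}-\frac{x}{\sigma_X\sigma_Y(1+\rho)}\Big).$$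 4. For $x<0$, $f_{S_n}(x)$ is obtained by replacing $(x,\rho,\mu_Y)$ by $(-x,-\rho,-\mu_Y)$ in the formulas of parts 1, 2 and 3 and in their hypotheses. If $\mu_X=\mu_Y=0$, the right-hand sides in parts 2 and 3 (and in the corresponding cases of part 4), which are then indeterminate, are understood as their limits as the parameter $\mu_X$ in them tends to $0$ through nonzero values, with $n,\sigma_X,\sigma_Y,\rho,x$ fixed. -/

import Mathlib

open MeasureTheory ProbabilityTheory Set Filter Topology

noncomputable section

namespace ProductNormal

/-- Modified Bessel function of the first kind of real order `ν`, by its power series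
`I_ν(z) = ∑ₖ (z/2)^(2k+ν) / (k! Γ(k+ν+1))`, for real arguments `z > 0`. -/
def besselI (ν z : ℝ) : ℝ :=
  ∑' k : ℕ, (z / 2) ^ (2 * (k : ℝ) + ν) / ((k.factorial : ℝ) * Real.Gamma ((k : ℝ) + ν + 1))

/-- Covariance matrix of a bivariate normal vector with standard deviations `σX`, `σY`
and correlation coefficient `ρ`. -/
def covMatrix (σX σY ρ : ℝ) : Matrix (Fin 2) (Fin 2) ℝ :=
  !![σX ^ 2, ρ * σX * σY; ρ * σX * σY, σY ^ 2]

/-- `(X, Y)` is a bivariate normal random vector with mean `(μX, μY)`, variances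
`(σX ^ 2, σY ^ 2)` and correlation coefficient `ρ`. -/
def IsBivariateNormal {Ω : Type*} [MeasurableSpace Ω] (X Y : Ω → ℝ) (μX μY σX σY ρ : ℝ)
    (Q : Measure Ω) : Prop :=
  HasLaw (fun ω => !₂[X ω, Y ω]) (multivariateGaussian !₂[μX, μY] (covMatrix σX σY ρ)) Q

/-- The prefactor when `|μX| / σX ≠ |μY| / σY`. -/
def D₁ (n : ℕ) (μX μY σX σY ρ x : ℝ) : ℝ :=
  1 / (σX * σY * (1 - ρ ^ 2)) * ((n : ℝ) / 4) ^ (1 - (n : ℝ) / 2)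
    * |μX ^ 2 / σX ^ 2 - μY ^ 2 / σY ^ 2| ^ (1 - (n : ℝ) / 2)
    * (x / (σX * σY)) ^ ((n : ℝ) / 2)
    * Real.exp (-((n : ℝ) / (2 * (1 - ρ ^ 2))
          * (μX ^ 2 / σX ^ 2 + μY ^ 2 / σY ^ 2 - 2 * ρ * μX * μY / (σX * σY)))
        - x / (σX * σY * (1 + ρ)))

/-- The integrand when `|μX| / σX ≠ |μY| / σY`. -/
def integrand₁ (n : ℕ) (μX μY σX σY ρ x t : ℝ) : ℝ :=
  (t * (t + 1)) ^ (((n : ℝ) - 2) / 4)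
    * Real.exp (-(2 * x * t / (σX * σY * (1 - ρ ^ 2))))
    * besselI ((n : ℝ) / 2 - 1)
        (|μX / σX - μY / σY| * (√(n * x * t) / ((1 - ρ) * √(σX * σY))))
    * besselI ((n : ℝ) / 2 - 1)
        (|μX / σX + μY / σY| * (√(n * x * (1 + t)) / ((1 + ρ) * √(σX * σY))))

/-- The prefactor when `μX / σX = μY / σY`. -/
def D₂ (n : ℕ) (μX σX σY ρ x : ℝ) : ℝ :=
  (n : ℝ) ^ ((2 - (n : ℝ)) / 4)
      / (σX * σY * (1 - ρ) ^ ((n : ℝ) / 2) * (1 + ρ) * Real.Gamma ((n : ℝ) / 2))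
    * (|μX| / σX) ^ (1 - (n : ℝ) / 2)
    * (x / (σX * σY)) ^ ((3 * (n : ℝ) - 2) / 4)
    * Real.exp (-((n : ℝ) * μX ^ 2 / (σX ^ 2 * (1 + ρ))) - x / (σX * σY * (1 + ρ)))

/-- The integrand when `μX / σX = μY / σY`. -/
def integrand₂ (n : ℕ) (μX σX σY ρ x t : ℝ) : ℝ :=
  (t ^ 2 * (t + 1)) ^ (((n : ℝ) - 2) / 4)
    * Real.exp (-(2 * x * t / (σX * σY * (1 - ρ ^ 2))))
    * besselI ((n : ℝ) / 2 - 1)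
        (2 * |μX| / σX * (√(n * x * (1 + t)) / ((1 + ρ) * √(σX * σY))))

/-- The prefactor when `μX / σX = -μY / σY`. -/
def D₃ (n : ℕ) (μX σX σY ρ x : ℝ) : ℝ :=
  (n : ℝ) ^ ((2 - (n : ℝ)) / 4)
      / (σX * σY * (1 + ρ) ^ ((n : ℝ) / 2) * (1 - ρ) * Real.Gamma ((n : ℝ) / 2))
    * (|μX| / σX) ^ (1 - (n : ℝ) / 2)
    * (x / (σX * σY)) ^ ((3 * (n : ℝ) - 2) / 4)
    * Real.exp (-((n : ℝ) * μX ^ 2 / (σX ^ 2 * (1 - ρ))) - x / (σX * σY * (1 + ρ)))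

/-- The integrand when `μX / σX = -μY / σY`. -/
def integrand₃ (n : ℕ) (μX σX σY ρ x t : ℝ) : ℝ :=
  ((t + 1) ^ 2 * t) ^ (((n : ℝ) - 2) / 4)
    * Real.exp (-(2 * x * t / (σX * σY * (1 - ρ ^ 2))))
    * besselI ((n : ℝ) / 2 - 1)
        (2 * |μX| / σX * (√(n * x * t) / ((1 - ρ) * √(σX * σY))))

/-- `y` is the value of the convergent integral formula `D · ∫₀^∞ g(t) dt`. -/
def EqIntegral (y D : ℝ) (g : ℝ → ℝ) : Prop :=
  IntegrableOn g (Ioi 0) ∧ y = D * ∫ t in Ioi (0 : ℝ), g t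

/-- `y` is given by the integral formula `D(μX) · ∫₀^∞ g(μX, t) dt` whose parameter is
`μX`. Where that formula is an indeterminate form, at `μX = 0`, it is read as its limit as
the parameter tends to `0`. -/
def EqIntegralOrLimit (y μX : ℝ) (D : ℝ → ℝ) (g : ℝ → ℝ → ℝ) : Prop :=
  (μX ≠ 0 → EqIntegral y (D μX) (g μX)) ∧
  (μX = 0 → (∀ m : ℝ, m ≠ 0 → IntegrableOn (g m) (Ioi 0)) ∧
    Tendsto (fun m : ℝ => D m * ∫ t in Ioi (0 : ℝ), g m t) (𝓝[≠] 0) (𝓝 y))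

end ProductNormal

end

/-! The product is a difference of independent squares. Put `U` and `V` equal to `√(σX σY) / 2`
times `X/σX + Y/σY` and `X/σX - Y/σY`. Then `XY = U² - V²`, and `U`, `V` are jointly normal and
uncorrelated (since `X/σX` and `Y/σY` have equal variances), hence independent, with variances `σX
σY (1 ± ρ) / 2`. So `S_n` is distributed as the difference of two independent sums of `n` Gaussian
squares, that is, of two scaled noncentral chi-square variables.

For a Gaussian of mean `m` and variance `1/(2r)`, such a sum is a Poisson mixture, with parameter `n
r m²`, of Gamma laws of rate `r` and shapes `n/2 + k`. Summing the mixture gives a power times an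
exponential times a Bessel series (`gammaMixture`). The identification of the laws is made on
characteristic functions: `integral_gammaMixture_mul_cexp` computes that of the mixture, and
`charFun_map_mul_of_isBivariateNormal` that of `XY`, whose `n`-th power multiplies shape and Poisson
parameter by `n`.

The density of `S_n` at `x > 0` is therefore `∫ g₁(y + x) g₂(y) dy`, and `y = x t` turns it into the
stated integrals (`eqIntegral_diffDensity_gammaMixture`). A vanishing mean of `U` or `V` reduces its
Bessel series to `1/Γ(n/2)`, which gives the two special cases; centred variables follow by
dominated convergence. Negative `x` amounts to exchanging `U` and `V`. -/

noncomputable section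

namespace ProductNormal

/-! ### The Bessel series. -/

/-- The entire function `u ↦ ∑ₖ u^k / (k! Γ(k+α))`, i.e. the Bessel function `I_(α-1)` without
its algebraic prefactor. -/
def besselSeries (α u : ℝ) : ℝ :=
  ∑' k : ℕ, u ^ k / ((k.factorial : ℝ) * Real.Gamma ((k : ℝ) + α))

section besselSeries

variable {α : ℝ}

lemma Gamma_natCast_add_pos (hα : 0 < α) (k : ℕ) : 0 < Real.Gamma ((k : ℝ) + α) :=
  Real.Gamma_pos_of_pos (by positivity)

/-- The ratio of consecutive terms is `v / (k + α)`, which tends to `0`. The series serves both as a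
majorant of the Bessel series and, at `v = δ⁻¹`, as the constant in its exponential bound. -/
lemma summable_pow_div_Gamma (hα : 0 < α) {v : ℝ} (hv : 0 < v) :
    Summable fun k : ℕ => v ^ k / Real.Gamma ((k : ℝ) + α) := by
  have hG := Gamma_natCast_add_pos hα
  refine summable_of_ratio_test_tendsto_lt_one (l := 0) one_pos
    (Eventually.of_forall fun k => (div_pos (pow_pos hv k) (hG k)).ne') ?_
  have h : ∀ k : ℕ, v / ((k : ℝ) + α) = ‖v ^ (k + 1) / Real.Gamma (((k + 1 : ℕ) : ℝ) + α)‖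
      / ‖v ^ k / Real.Gamma ((k : ℝ) + α)‖ := by
    intro k
    have hk : (0 : ℝ) < (k : ℝ) + α := by positivity
    rw [Real.norm_of_nonneg (div_pos (pow_pos hv _) (hG _)).le,
      Real.norm_of_nonneg (div_pos (pow_pos hv _) (hG _)).le,
      show (((k + 1 : ℕ) : ℝ) + α) = ((k : ℝ) + α) + 1 by push_cast; ring,
      Real.Gamma_add_one hk.ne']
    have := (hG k).ne'
    field_simp
    ring
  exact Tendsto.congr h (tendsto_const_nhds.div_atTop
    (tendsto_atTop_add_const_right _ _ tendsto_natCast_atTop_atTop))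

lemma summable_besselSeries (hα : 0 < α) {u : ℝ} (hu : 0 ≤ u) :
    Summable fun k : ℕ => u ^ k / ((k.factorial : ℝ) * Real.Gamma ((k : ℝ) + α)) := by
  have hG := Gamma_natCast_add_pos hα
  refine Summable.of_nonneg_of_le (fun k => ?_) (fun k => ?_)
    (summable_pow_div_Gamma hα (v := u + 1) (by linarith))
  · have := hG k
    positivity
  · have h1 : (1 : ℝ) ≤ k.factorial := by exact_mod_cast k.factorial_pos
    exact div_le_div₀ (by positivity) (pow_le_pow_left₀ hu (by linarith) k) (hG k)
      (by nlinarith [hG k])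

lemma besselSeries_nonneg (hα : 0 < α) {u : ℝ} (hu : 0 ≤ u) : 0 ≤ besselSeries α u :=
  tsum_nonneg fun k => by
    have := Gamma_natCast_add_pos hα k
    positivity

lemma besselSeries_mono (hα : 0 < α) {u v : ℝ} (hu : 0 ≤ u) (huv : u ≤ v) :
    besselSeries α u ≤ besselSeries α v := by
  refine Summable.tsum_le_tsum (fun k => ?_) (summable_besselSeries hα hu)
    (summable_besselSeries hα (hu.trans huv))
  have := Gamma_natCast_add_pos hα k
  gcongr

lemma continuous_besselSeries (hα : 0 < α) : Continuous (besselSeries α) := by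
  have hG := Gamma_natCast_add_pos hα
  rw [continuous_iff_continuousAt]
  intro u
  have h : ContinuousOn (besselSeries α) (Icc (-(|u| + 1)) (|u| + 1)) := by
    refine continuousOn_tsum (fun k => by fun_prop)
      (summable_besselSeries hα (u := |u| + 1) (by positivity)) ?_
    intro k v hv
    have := hG k
    rw [norm_div, norm_pow, Real.norm_of_nonneg
      (show (0 : ℝ) ≤ (k.factorial : ℝ) * Real.Gamma ((k : ℝ) + α) by positivity)]
    gcongr
    exact abs_le.2 hv
  exact h.continuousAt (Icc_mem_nhds (by linarith [neg_abs_le u]) (by linarith [le_abs_self u]))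

lemma besselSeries_zero : besselSeries α 0 = (Real.Gamma α)⁻¹ := by
  rw [besselSeries, tsum_eq_single 0]
  · simp
  · intro k hk
    simp [hk]

/-- The Bessel series grows more slowly than any exponential. -/
lemma exists_besselSeries_le_exp (hα : 0 < α) {δ : ℝ} (hδ : 0 < δ) :
    ∃ C, 0 ≤ C ∧ ∀ u, 0 ≤ u → besselSeries α u ≤ C * Real.exp (δ * u) := by
  have hG := Gamma_natCast_add_pos hα
  have hs := summable_pow_div_Gamma hα (inv_pos.2 hδ)
  refine ⟨∑' k : ℕ, δ⁻¹ ^ k / Real.Gamma ((k : ℝ) + α), tsum_nonneg fun k => ?_, fun u hu => ?_⟩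
  · have := hG k
    positivity
  rw [besselSeries, ← tsum_mul_right]
  refine Summable.tsum_le_tsum (fun k => ?_) (summable_besselSeries hα hu) (hs.mul_right _)
  have hk := hG k
  -- Each `(δu)^k / k!` is at most `exp (δu)`; what remains of the term, `δ⁻¹^k / Γ(k+α)`, is still
  -- summable.
  have h1 := Real.pow_div_factorial_le_exp (δ * u) (by positivity) k
  calc u ^ k / ((k.factorial : ℝ) * Real.Gamma ((k : ℝ) + α))
      = δ⁻¹ ^ k / Real.Gamma ((k : ℝ) + α) * ((δ * u) ^ k / k.factorial) := by
        rw [mul_pow, inv_pow]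
        field_simp
    _ ≤ _ := by gcongr

lemma besselI_eq {z : ℝ} (hz : 0 < z) :
    besselI (α - 1) z = (z / 2) ^ (α - 1) * besselSeries α (z ^ 2 / 4) := by
  rw [besselI, besselSeries, ← tsum_mul_left]
  refine tsum_congr fun k => ?_
  rw [Real.rpow_add (by positivity), show (2 : ℝ) * (k : ℝ) = ((2 * k : ℕ) : ℝ) by push_cast; ring,
    Real.rpow_natCast, pow_mul, show (z / 2) ^ 2 = z ^ 2 / 4 by ring,
    show (k : ℝ) + (α - 1) + 1 = (k : ℝ) + α by ring]
  ring

end besselSeries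

/-! ### The Laplace transform of a power. -/

/-- The Laplace transform of the power function, at complex arguments. -/
lemma integral_rpow_mul_cexp_neg_mul_Ioi {a : ℝ} (ha : 0 < a) {w : ℂ} (hw : 0 < w.re) :
    ∫ t : ℝ in Ioi 0, ((t ^ (a - 1) : ℝ) : ℂ) * Complex.exp (-(w * t))
      = (Real.Gamma a : ℂ) * w ^ (-(a : ℂ)) := by
  -- With `t^(a-1) dt` as a measure, the integral is its complex moment generating function at `z =
  -- -w`, analytic on the left half-plane. The formula is known for real `z < 0` and extends by the
  -- identity theorem.
  set μ : Measure ℝ := (volume.restrict (Ioi 0)).withDensity fun t => ENNReal.ofReal (t ^ (a - 1))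
    with hμ
  have hmeas : Measurable fun t : ℝ => ENNReal.ofReal (t ^ (a - 1)) := by fun_prop
  have hlt : ∀ᵐ t ∂(volume.restrict (Ioi (0 : ℝ))), ENNReal.ofReal (t ^ (a - 1)) < ⊤ :=
    ae_of_all _ fun _ => ENNReal.ofReal_lt_top
  have hexp : Iio 0 ⊆ integrableExpSet id μ := by
    intro x hx
    have hx' : 0 < -x := by simpa using hx
    rw [integrableExpSet, mem_ofPred_eq, hμ,
      integrable_withDensity_iff_integrable_smul' hmeas hlt]
    have hint : IntegrableOn (fun t : ℝ => t ^ (a - 1) * Real.exp (-(-x * t))) (Ioi 0) := by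
      -- A non-integrable function has integral `0` by convention, whereas the known value is
      -- positive.
      by_contra hc
      have h0 := integral_undef hc
      rw [Real.integral_rpow_mul_exp_neg_mul_Ioi ha hx'] at h0
      exact (mul_pos (by positivity) (Real.Gamma_pos_of_pos ha)).ne' h0
    refine hint.congr_fun (fun t ht => ?_) measurableSet_Ioi
    have ht' : (0 : ℝ) < t := ht
    simp [ENNReal.toReal_ofReal (Real.rpow_nonneg ht'.le _)]
  have hmgf : ∀ z : ℂ, complexMGF id μ z
      = ∫ t : ℝ in Ioi 0, ((t ^ (a - 1) : ℝ) : ℂ) * Complex.exp (z * t) := by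
    intro z
    rw [complexMGF, hμ, integral_withDensity_eq_integral_toReal_smul hmeas hlt]
    refine setIntegral_congr_fun measurableSet_Ioi fun t ht => ?_
    have ht' : (0 : ℝ) < t := ht
    simp [ENNReal.toReal_ofReal (Real.rpow_nonneg ht'.le _)]
  set U : Set ℂ := {z | z.re < 0} with hU
  have hUopen : IsOpen U := isOpen_lt Complex.continuous_re continuous_const
  have hUconv : IsPreconnected U := (convex_halfSpace_re_lt 0).isPreconnected
  have hA : AnalyticOnNhd ℂ (complexMGF id μ) U := by
    refine DifferentiableOn.analyticOnNhd (differentiableOn_complexMGF.mono fun z hz => ?_) hUopen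
    exact interior_mono hexp (by simpa [interior_Iio] using (show z.re < 0 from hz))
  have hB : AnalyticOnNhd ℂ (fun z : ℂ => (Real.Gamma a : ℂ) * (-z) ^ (-(a : ℂ))) U := by
    refine DifferentiableOn.analyticOnNhd (fun z hz => ?_) hUopen
    refine DifferentiableAt.differentiableWithinAt ?_
    refine DifferentiableAt.const_mul ?_ _
    refine (differentiableAt_id.neg).cpow (differentiableAt_const _) ?_
    left
    simpa using (show z.re < 0 from hz)
  have hreal : ∀ x : ℝ, x < 0 →
      complexMGF id μ x = (Real.Gamma a : ℂ) * (-(x : ℂ)) ^ (-(a : ℂ)) := by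
    intro x hx
    have hx' : 0 < -x := by linarith
    have h := Real.integral_rpow_mul_exp_neg_mul_Ioi ha hx'
    rw [hmgf]
    have e1 : ∀ t : ℝ, ((t ^ (a - 1) : ℝ) : ℂ) * Complex.exp ((x : ℂ) * t)
        = ((t ^ (a - 1) * Real.exp (-(-x * t)) : ℝ) : ℂ) := by
      intro t
      push_cast
      ring_nf
    simp_rw [e1]
    rw [integral_complex_ofReal, h]
    push_cast
    rw [mul_comm, Complex.ofReal_cpow (by positivity)]
    rw [← Complex.ofReal_neg, ← Complex.ofReal_neg, ← Complex.ofReal_cpow hx'.le,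
      ← Complex.ofReal_cpow (by positivity), one_div, Real.inv_rpow hx'.le,
      Real.rpow_neg hx'.le]
  have hmem : (-1 : ℂ) ∈ U := by simp [hU]
  -- The identity theorem needs agreement arbitrarily close to one point of the half-plane; `-1`,
  -- approached along the real axis, is an arbitrary choice.
  have hfreq : ∃ᶠ z in 𝓝[≠] (-1 : ℂ),
      complexMGF id μ z = (Real.Gamma a : ℂ) * (-z) ^ (-(a : ℂ)) := by
    have ht : Tendsto (fun x : ℝ => (x : ℂ)) (𝓝[≠] (-1 : ℝ)) (𝓝[≠] (-1 : ℂ)) := by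
      refine tendsto_nhdsWithin_iff.2 ⟨?_, ?_⟩
      · have : Tendsto (fun x : ℝ => (x : ℂ)) (𝓝 (-1 : ℝ)) (𝓝 ((-1 : ℝ) : ℂ)) :=
          Complex.continuous_ofReal.tendsto _
        simpa using this.mono_left nhdsWithin_le_nhds
      · filter_upwards [self_mem_nhdsWithin] with x hx
        intro h
        apply hx
        have h' : (x : ℂ) = ((-1 : ℝ) : ℂ) := by simpa using h
        exact Complex.ofReal_injective h'
    refine ht.frequently (Eventually.frequently ?_)
    filter_upwards [mem_nhdsWithin_of_mem_nhds (Iio_mem_nhds (show (-1 : ℝ) < 0 by norm_num))]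
      with x hx using hreal x hx
  have hEq := hA.eqOn_of_preconnected_of_frequently_eq hB hUconv hmem hfreq
  have hw' : -w ∈ U := by simpa [hU] using hw
  have := hEq hw'
  rw [hmgf] at this
  simpa using this

/-! ### Noncentral chi-square densities as Poisson mixtures. -/

/-- The density of the mixture of the Gamma distributions of shape `α + k` and rate `r` with
Poisson weights of parameter `κ`: a rescaled noncentral chi-square density. -/
def gammaMixture (α r κ y : ℝ) : ℝ :=
  (Ioi 0).indicator (fun y => r ^ α * Real.exp (-κ) * y ^ (α - 1) * Real.exp (-(r * y))
    * besselSeries α (κ * r * y)) y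

section gammaMixture

variable {α r κ : ℝ}

lemma gammaMixture_of_pos {y : ℝ} (hy : 0 < y) :
    gammaMixture α r κ y = r ^ α * Real.exp (-κ) * y ^ (α - 1) * Real.exp (-(r * y))
      * besselSeries α (κ * r * y) :=
  indicator_of_mem (s := Ioi 0) hy _

lemma gammaMixture_of_nonpos {y : ℝ} (hy : y ≤ 0) : gammaMixture α r κ y = 0 :=
  indicator_of_notMem (by simpa using hy) _

lemma gammaMixture_nonneg (hα : 0 < α) (hr : 0 < r) (hκ : 0 ≤ κ) (y : ℝ) :
    0 ≤ gammaMixture α r κ y := by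
  refine indicator_nonneg (fun y hy => ?_) y
  have hy' : (0 : ℝ) < y := hy
  have := besselSeries_nonneg hα (u := κ * r * y) (by positivity)
  positivity

lemma measurable_gammaMixture (hα : 0 < α) : Measurable (gammaMixture α r κ) := by
  have := (continuous_besselSeries hα).measurable
  exact Measurable.indicator (by fun_prop) measurableSet_Ioi

lemma continuousAt_gammaMixture (hα : 0 < α) {y : ℝ} (hy : 0 < y) :
    ContinuousAt (gammaMixture α r κ) y := by
  have hc := continuous_besselSeries hα
  have h : ContinuousAt (fun y : ℝ => r ^ α * Real.exp (-κ) * y ^ (α - 1) * Real.exp (-(r * y))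
    * besselSeries α (κ * r * y)) y := by
    have h1 : ContinuousAt (fun y : ℝ => y ^ (α - 1)) y :=
      Real.continuousAt_rpow_const _ _ (Or.inl hy.ne')
    fun_prop
  refine h.congr ?_
  filter_upwards [Ioi_mem_nhds hy] with z hz using (gammaMixture_of_pos hz).symm

lemma continuous_gammaMixture_param (hα : 0 < α) (y : ℝ) :
    Continuous fun κ => gammaMixture α r κ y := by
  have hc := continuous_besselSeries hα
  rcases le_or_gt y 0 with hy | hy
  · simp_rw [gammaMixture_of_nonpos hy]
    exact continuous_const
  · simp_rw [gammaMixture_of_pos hy]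
    fun_prop

/-- The Bessel series increases with `κ` but `exp (-κ)` decreases; the factor `exp K` cancels the
`exp (-K)` on the right. This gives a majorant uniform in `κ ≤ K`. -/
lemma gammaMixture_le_exp_mul (hα : 0 < α) (hr : 0 < r) {K : ℝ} (hκ : 0 ≤ κ) (hK : κ ≤ K)
    (y : ℝ) : gammaMixture α r κ y ≤ Real.exp K * gammaMixture α r K y := by
  rcases le_or_gt y 0 with hy | hy
  · simp [gammaMixture_of_nonpos hy]
  · rw [gammaMixture_of_pos hy, gammaMixture_of_pos hy]
    have h0 := besselSeries_nonneg hα (u := κ * r * y) (by positivity)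
    have h1 := besselSeries_mono hα (u := κ * r * y) (v := K * r * y) (by positivity)
      (by gcongr)
    calc _ ≤ r ^ α * 1 * y ^ (α - 1) * Real.exp (-(r * y)) * besselSeries α (K * r * y) := by
          gcongr
          simpa using hκ
      _ = _ := by
          rw [Real.exp_neg K]
          field_simp

/-- The bound holds only away from `0`, because `y^(α-1)` blows up there when `α < 1`, which is the
case `n = 1`. -/
lemma exists_gammaMixture_le (hα : 0 < α) (hr : 0 < r) (hκ : 0 ≤ κ) {ε : ℝ} (hε : 0 < ε) :
    ∃ C, ∀ y, ε ≤ y → gammaMixture α r κ y ≤ C := by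
  -- This `δ` makes the growth of the series at most `exp (r y / 2)`, so half of the decay `exp (-r
  -- y)` survives. The `+ 1` covers `κ = 0`.
  obtain ⟨C, hC0, hC⟩ := exists_besselSeries_le_exp hα (δ := (2 * (κ + 1))⁻¹) (by positivity)
  set h : ℝ → ℝ := fun y => y ^ (α - 1) * Real.exp (-(r / 2) * y) with hh
  have hlim : Tendsto h atTop (𝓝 0) :=
    tendsto_rpow_mul_exp_neg_mul_atTop_nhds_zero (α - 1) (r / 2) (by positivity)
  obtain ⟨N, hN⟩ := eventually_atTop.1 (hlim.eventually (ge_mem_nhds one_pos))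
  have hcont : ContinuousOn h (Icc ε (max N ε)) := by
    intro y hy
    have hy0 : 0 < y := hε.trans_le hy.1
    have h1 : ContinuousAt (fun y : ℝ => y ^ (α - 1)) y :=
      Real.continuousAt_rpow_const _ _ (Or.inl hy0.ne')
    exact (h1.mul (by fun_prop)).continuousWithinAt
  obtain ⟨M, hM⟩ := isCompact_Icc.exists_bound_of_continuousOn hcont
  have hb : ∀ y, ε ≤ y → h y ≤ max M 1 := by
    intro y hy
    rcases le_total y (max N ε) with h1 | h1
    · exact ((le_abs_self _).trans (hM y ⟨hy, h1⟩)).trans (le_max_left _ _)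
    · exact (hN y ((le_max_left _ _).trans h1)).trans (le_max_right _ _)
  refine ⟨r ^ α * C * max M 1, fun y hy => ?_⟩
  have hy0 : 0 < y := hε.trans_le hy
  rw [gammaMixture_of_pos hy0]
  have h1 := hC (κ * r * y) (by positivity)
  have h0 := besselSeries_nonneg hα (u := κ * r * y) (by positivity)
  have h2 : Real.exp ((2 * (κ + 1))⁻¹ * (κ * r * y)) ≤ Real.exp (r / 2 * y) := by
    rw [Real.exp_le_exp, inv_mul_le_iff₀ (by positivity)]
    nlinarith [mul_pos hr hy0]
  calc _ ≤ r ^ α * 1 * y ^ (α - 1) * Real.exp (-(r * y)) * (C * Real.exp (r / 2 * y)) := by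
        gcongr
        · simpa using hκ
        · exact h1.trans (by gcongr)
    _ = r ^ α * C * h y := by
        have : Real.exp (-(r * y)) = Real.exp (-(r / 2) * y) * (Real.exp (r / 2 * y))⁻¹ := by
          rw [← Real.exp_neg, ← Real.exp_add]
          ring_nf
        rw [this, hh]
        field_simp
    _ ≤ _ := by
        gcongr
        exact hb y hy

/-- The Fourier transform of a Poisson mixture of Gamma densities. -/
lemma integral_gammaMixture_mul_cexp (hα : 0 < α) (hr : 0 < r) (hκ : 0 ≤ κ) {w : ℂ}
    (hw : w.re = r) :
    ∫ y : ℝ, (gammaMixture α r κ y : ℂ) * Complex.exp ((r - w) * y)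
      = ((r ^ α : ℝ) : ℂ) * w ^ (-(α : ℂ)) * Complex.exp (κ * (r / w) - κ) := by
  have hG := Gamma_natCast_add_pos hα
  have hw0 : w ≠ 0 := by
    rintro rfl
    simp at hw
    exact hr.ne hw
  -- The Poisson weight `e^(-κ) κ^k / k!` times the normalisation `r^(α+k) / Γ(k+α)` of the Gamma
  -- density. Since `w.re = r`, the factor `exp ((r - w) y)` has modulus one and turns `exp (-r y)`
  -- into `exp (-w y)`.
  let c : ℕ → ℝ := fun k => Real.exp (-κ) * κ ^ k / k.factorial * r ^ α * r ^ k
    / Real.Gamma ((k : ℝ) + α)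
  have hc0 : ∀ k, 0 ≤ c k := fun k => by
    have := hG k
    positivity
  let F : ℕ → ℝ → ℂ := fun k y =>
    (c k : ℂ) * (((y ^ ((k : ℝ) + α - 1) : ℝ) : ℂ) * Complex.exp (-(w * y)))
  have hFint : ∀ k, ∫ y in Ioi 0, F k y = Complex.exp (-κ) * ((r ^ α : ℝ) : ℂ) * w ^ (-(α : ℂ))
      * ((κ * (r / w)) ^ k / k.factorial) := by
    intro k
    have hk : (0 : ℝ) < (k : ℝ) + α := by positivity
    have hGk : ((Real.Gamma ((k : ℝ) + α) : ℝ) : ℂ) ≠ 0 := by exact_mod_cast (hG k).ne'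
    simp only [F]
    rw [integral_const_mul, integral_rpow_mul_cexp_neg_mul_Ioi hk (by rw [hw]; exact hr)]
    have e1 : w ^ (-(((k : ℝ) + α : ℝ) : ℂ)) = w ^ (-(α : ℂ)) * (w ^ k)⁻¹ := by
      rw [show (-(((k : ℝ) + α : ℝ) : ℂ)) = -(α : ℂ) + -(k : ℂ) by push_cast; ring,
        Complex.cpow_add _ _ hw0, Complex.cpow_neg w k, Complex.cpow_natCast]
    rw [e1, mul_pow, div_pow]
    simp only [c]
    push_cast
    field_simp
  have hnorm : ∀ k, ∀ y ∈ Ioi (0 : ℝ), ‖F k y‖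
      = c k * (y ^ ((k : ℝ) + α - 1) * Real.exp (-(r * y))) := by
    intro k y hy
    have hy' : (0 : ℝ) < y := hy
    simp only [F]
    rw [norm_mul, norm_mul, Complex.norm_real, Complex.norm_real, Complex.norm_exp,
      Real.norm_of_nonneg (hc0 k), Real.norm_of_nonneg (by positivity)]
    simp [hw]
  have hIntF : ∀ k, IntegrableOn (F k) (Ioi 0) := by
    intro k
    by_contra hcon
    have hk : (0 : ℝ) < (k : ℝ) + α := by positivity
    have hint : IntegrableOn (fun t : ℝ => ((t ^ ((k : ℝ) + α - 1) : ℝ) : ℂ)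
        * Complex.exp (-(w * t))) (Ioi 0) := by
      by_contra hc
      have h0 := integral_undef hc
      rw [integral_rpow_mul_cexp_neg_mul_Ioi hk (by rw [hw]; exact hr)] at h0
      have : w ^ (-(((k : ℝ) + α : ℝ) : ℂ)) ≠ 0 := by simp [Complex.cpow_eq_zero_iff, hw0]
      have hGk : ((Real.Gamma ((k : ℝ) + α) : ℝ) : ℂ) ≠ 0 := by exact_mod_cast (hG k).ne'
      exact mul_ne_zero hGk this h0
    exact hcon (hint.const_mul _)
  -- The norms integrate to the Poisson weights, which are summable; this licenses exchanging sum
  -- and integral.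
  have hnormint : ∀ k, ∫ y in Ioi 0, ‖F k y‖ = Real.exp (-κ) * (κ ^ k / k.factorial) := by
    intro k
    have hk : (0 : ℝ) < (k : ℝ) + α := by positivity
    rw [setIntegral_congr_fun measurableSet_Ioi (hnorm k), integral_const_mul,
      Real.integral_rpow_mul_exp_neg_mul_Ioi hk hr]
    simp only [c]
    have := (hG k).ne'
    rw [one_div, Real.inv_rpow hr.le, Real.rpow_add hr, Real.rpow_natCast]
    have : r ^ α ≠ 0 := by positivity
    field_simp
  have hsum : Summable fun k => ∫ y in Ioi 0, ‖F k y‖ := by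
    simp_rw [hnormint]
    exact (Real.summable_pow_div_factorial κ).mul_left _
  have hHS := hasSum_integral_of_summable_integral_norm hIntF hsum
  have hexp : HasSum (fun k => ∫ y in Ioi 0, F k y) (Complex.exp (-κ) * ((r ^ α : ℝ) : ℂ)
      * w ^ (-(α : ℂ)) * Complex.exp (κ * (r / w))) := by
    simp_rw [hFint]
    refine HasSum.mul_left _ ?_
    rw [Complex.exp_eq_exp_ℂ]
    exact NormedSpace.expSeries_div_hasSum_exp (κ * (r / w) : ℂ)
  have hval := hHS.unique hexp
  have hpt : ∀ y ∈ Ioi (0 : ℝ), (gammaMixture α r κ y : ℂ) * Complex.exp ((r - w) * y)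
      = ∑' k, F k y := by
    intro y hy
    have hy' : (0 : ℝ) < y := hy
    rw [gammaMixture_of_pos hy', besselSeries, ← tsum_mul_left, Complex.ofReal_tsum,
      ← tsum_mul_right]
    refine tsum_congr fun k => ?_
    simp only [F, c]
    have e2 : Complex.exp (-(w * y)) = Complex.exp ((r - w) * y) * Complex.exp (-(r * y)) := by
      rw [← Complex.exp_add]
      ring_nf
    have e3 : y ^ ((k : ℝ) + α - 1) = y ^ k * y ^ (α - 1) := by
      rw [← Real.rpow_natCast y k, ← Real.rpow_add hy']
      ring_nf
    rw [e2, e3, mul_pow, mul_pow]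
    push_cast
    field_simp
  have hind : ∀ y ∉ Ioi (0 : ℝ), (gammaMixture α r κ y : ℂ) * Complex.exp ((r - w) * y) = 0 := by
    intro y hy
    simp [gammaMixture_of_nonpos (α := α) (r := r) (κ := κ) (y := y) (by simpa using hy)]
  rw [← setIntegral_eq_integral_of_forall_compl_eq_zero hind,
    setIntegral_congr_fun measurableSet_Ioi hpt, hval, sub_eq_add_neg, Complex.exp_add]
  ring

/-- This is the Fourier transform at frequency zero, `w = r`. -/
lemma integral_gammaMixture (hα : 0 < α) (hr : 0 < r) (hκ : 0 ≤ κ) :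
    ∫ y, gammaMixture α r κ y = 1 := by
  have h := integral_gammaMixture_mul_cexp hα hr hκ (w := r) (by simp)
  have hr' : (r : ℂ) ≠ 0 := by exact_mod_cast hr.ne'
  simp only [sub_self, zero_mul, Complex.exp_zero, mul_one, div_self hr'] at h
  rw [integral_complex_ofReal, Complex.ofReal_cpow hr.le, ← Complex.cpow_add _ _ hr'] at h
  simpa using h

lemma integrable_gammaMixture (hα : 0 < α) (hr : 0 < r) (hκ : 0 ≤ κ) :
    Integrable (gammaMixture α r κ) := by
  by_contra hc
  have := integral_gammaMixture hα hr hκ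
  rw [integral_undef hc] at this
  exact zero_ne_one this

end gammaMixture

/-! ### Characteristic functions and the difference of squares. -/

/-- The characteristic function of a measure with real density. -/
lemma charFun_withDensity_ofReal {g : ℝ → ℝ} (hg : Measurable g) (hg0 : ∀ y, 0 ≤ g y) (t : ℝ) :
    charFun (volume.withDensity fun y => ENNReal.ofReal (g y)) t
      = ∫ y, (g y : ℂ) * Complex.exp (t * y * Complex.I) := by
  rw [charFun_apply_real, integral_withDensity_eq_integral_toReal_smul (by fun_prop)
    (ae_of_all _ fun _ => ENNReal.ofReal_lt_top)]
  simp [ENNReal.toReal_ofReal (hg0 _)]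

/-- The Fourier transform of the square of a Gaussian variable. -/
lemma integral_cexp_sq_gaussianReal {m r : ℝ} (hr : 0 < r) {v : NNReal} (hv : (v : ℝ) = 1 / (2 * r))
    {w : ℂ} (hw : w.re = r) :
    ∫ p, Complex.exp ((r - w) * p ^ 2) ∂(gaussianReal m v)
      = ((r ^ (1 / 2 : ℝ) : ℝ) : ℂ) * w ^ (-(1 / 2 : ℂ))
        * Complex.exp ((r * m ^ 2 : ℝ) * (r / w) - (r * m ^ 2 : ℝ)) := by
  have hw0 : w ≠ 0 := by
    rintro rfl
    simp at hw
    exact hr.ne hw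
  have hv0 : v ≠ 0 := by
    rintro rfl
    simp at hv
    exact hr.ne' hv
  have hπ : (0 : ℝ) < Real.pi := Real.pi_pos
  rw [integral_gaussianReal_eq_integral_smul hv0]
  -- Variance `1/(2r)` gives the Gaussian exponent `-r (p - m)²`, whose `-r p²` cancels against `(r
  -- - w) p²` and leaves `-w p²`.
  have e : ∀ p : ℝ, gaussianPDFReal m v p • Complex.exp ((r - w) * p ^ 2)
      = (((r / Real.pi) ^ (1 / 2 : ℝ) : ℝ) : ℂ)
        * Complex.exp (-w * p ^ 2 + 2 * r * m * p + -(r * m ^ 2)) := by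
    intro p
    rw [gaussianPDFReal, hv, Complex.real_smul]
    have e1 : (√(2 * Real.pi * (1 / (2 * r))))⁻¹ = (r / Real.pi) ^ (1 / 2 : ℝ) := by
      rw [← Real.sqrt_inv, Real.sqrt_eq_rpow]
      congr 1
      field_simp
    rw [e1, Complex.ofReal_mul, mul_assoc, Complex.ofReal_exp, ← Complex.exp_add]
    congr 2
    have hr' : (r : ℂ) ≠ 0 := by exact_mod_cast hr.ne'
    push_cast
    field_simp
    ring
  simp_rw [e]
  rw [integral_const_mul, integral_cexp_quadratic (by simpa [hw] using hr)]
  have e2 : ((((r / Real.pi) ^ (1 / 2 : ℝ) : ℝ) : ℂ)) * ((Real.pi : ℂ) / - -w) ^ (1 / 2 : ℂ)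
      = ((r ^ (1 / 2 : ℝ) : ℝ) : ℂ) * w ^ (-(1 / 2 : ℂ)) := by
    have hπ' : (Real.pi : ℂ) ≠ 0 := by exact_mod_cast hπ.ne'
    -- As `w` has positive real part it avoids the branch cut, so the principal logarithm of `w⁻¹`
    -- is `-log w`.
    have harg : w.arg ≠ Real.pi := by
      rw [Ne, Complex.arg_eq_pi_iff, not_and_or, not_lt]
      left
      rw [hw]
      exact hr.le
    rw [neg_neg, div_eq_mul_inv (Real.pi : ℂ) w,
      Complex.cpow_def_of_ne_zero (mul_ne_zero hπ' (inv_ne_zero hw0)),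
      Complex.log_ofReal_mul hπ (inv_ne_zero hw0), Complex.log_inv _ harg,
      Complex.cpow_def_of_ne_zero hw0, Real.div_rpow hr.le hπ.le,
      Real.rpow_def_of_pos hπ, add_mul, Complex.exp_add]
    push_cast
    have : Complex.exp (Real.log Real.pi * (1 / 2)) ≠ 0 := Complex.exp_ne_zero _
    field_simp
  rw [← mul_assoc, e2]
  congr 2
  push_cast
  field_simp
  ring

lemma posSemidef_covMatrix (σX σY : ℝ) {ρ : ℝ} (hρ : ρ ∈ Ioo (-1 : ℝ) 1) :
    (covMatrix σX σY ρ).PosSemidef := by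
  refine Matrix.PosSemidef.of_dotProduct_mulVec_nonneg ?_ fun x => ?_
  · ext i j
    fin_cases i <;> fin_cases j <;> simp [covMatrix]
  · have hρ2 : 0 ≤ 1 - ρ ^ 2 := by nlinarith [hρ.1, hρ.2]
    simp only [covMatrix, Matrix.mulVec, dotProduct, Fin.sum_univ_two, Matrix.of_apply,
      Matrix.cons_val', Matrix.cons_val_zero, Matrix.cons_val_one, Pi.star_apply, star_trivial]
    -- Completing the square in the covariance form.
    have h := add_nonneg (sq_nonneg (σX * x 0 + ρ * σY * x 1))
      (mul_nonneg hρ2 (sq_nonneg (σY * x 1)))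
    convert h using 1
    ring

/-- A bivariate normal vector is a linear image of two independent normal variables, in such a way
that the product of its coordinates is a difference of squares. -/
lemma multivariateGaussian_eq_map_prod (μX μY : ℝ) {σX σY ρ : ℝ} (hσX : 0 < σX) (hσY : 0 < σY)
    (hρ : ρ ∈ Ioo (-1 : ℝ) 1) {v₁ v₂ : NNReal} (hv₁ : (v₁ : ℝ) = σX * σY * (1 + ρ) / 2)
    (hv₂ : (v₂ : ℝ) = σX * σY * (1 - ρ) / 2) :
    multivariateGaussian !₂[μX, μY] (covMatrix σX σY ρ)
      = ((gaussianReal ((μX / σX + μY / σY) * √(σX * σY) / 2) v₁).prod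
          (gaussianReal ((μX / σX - μY / σY) * √(σX * σY) / 2) v₂)).map
        fun q => !₂[σX * (q.1 + q.2) / √(σX * σY), σY * (q.1 - q.2) / √(σX * σY)] := by
  set S := √(σX * σY) with hS
  have hS0 : 0 < S := Real.sqrt_pos.2 (mul_pos hσX hσY)
  have hS2 : S ^ 2 = σX * σY := Real.sq_sqrt (mul_pos hσX hσY).le
  have hmeas : Measurable fun q : ℝ × ℝ => !₂[σX * (q.1 + q.2) / S, σY * (q.1 - q.2) / S] := by
    refine (WithLp.measurable_toLp 2 _).comp ?_
    refine measurable_pi_lambda _ fun i => ?_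
    fin_cases i <;> simp <;> fun_prop
  have := Measure.isProbabilityMeasure_map (μ := ((gaussianReal ((μX / σX + μY / σY) * S / 2) v₁).prod
          (gaussianReal ((μX / σX - μY / σY) * S / 2) v₂))) hmeas.aemeasurable
  refine Measure.ext_of_charFun (funext fun t => ?_)
  rw [charFun_multivariateGaussian (posSemidef_covMatrix σX σY hρ), charFun_apply,
    integral_map hmeas.aemeasurable (by fun_prop)]
  have e : ∀ q : ℝ × ℝ, Complex.exp ((inner ℝ (!₂[σX * (q.1 + q.2) / S, σY * (q.1 - q.2) / S]) t : ℝ)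
      * Complex.I) = Complex.exp (((t 0 * σX + t 1 * σY) / S : ℝ) * q.1 * Complex.I)
        * Complex.exp (((t 0 * σX - t 1 * σY) / S : ℝ) * q.2 * Complex.I) := by
    intro q
    rw [← Complex.exp_add]
    congr 1
    simp [PiLp.inner_apply, Fin.sum_univ_two]
    ring
  simp_rw [e]
  rw [integral_prod_mul (fun p : ℝ => Complex.exp (((t 0 * σX + t 1 * σY) / S : ℝ) * p * Complex.I))
    (fun p : ℝ => Complex.exp (((t 0 * σX - t 1 * σY) / S : ℝ) * p * Complex.I)),
    ← charFun_apply_real, ← charFun_apply_real, charFun_gaussianReal, charFun_gaussianReal,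
    ← Complex.exp_add]
  congr 1
  have e1 : (inner ℝ t !₂[μX, μY] : ℝ) = t 0 * μX + t 1 * μY := by
    simp [PiLp.inner_apply, Fin.sum_univ_two]
    ring
  have e2 : (t : Fin 2 → ℝ) ⬝ᵥ (covMatrix σX σY ρ).mulVec t
      = (t 0 * σX) ^ 2 + 2 * ρ * (t 0 * σX) * (t 1 * σY) + (t 1 * σY) ^ 2 := by
    simp [covMatrix, Matrix.mulVec, dotProduct, Fin.sum_univ_two]
    ring
  rw [e1, e2]
  have e3 : (t 0 * σX + t 1 * σY) / S * ((μX / σX + μY / σY) * S / 2)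
      + (t 0 * σX - t 1 * σY) / S * ((μX / σX - μY / σY) * S / 2) = t 0 * μX + t 1 * μY := by
    field_simp
    ring
  have e4 : (v₁ : ℝ) * ((t 0 * σX + t 1 * σY) / S) ^ 2 + (v₂ : ℝ) * ((t 0 * σX - t 1 * σY) / S) ^ 2
      = (t 0 * σX) ^ 2 + 2 * ρ * (t 0 * σX) * (t 1 * σY) + (t 1 * σY) ^ 2 := by
    rw [div_pow, div_pow, hS2, hv₁, hv₂]
    field_simp
    ring
  rw [← e3, ← e4]
  push_cast
  ring

/-- The characteristic function of the product of the coordinates of a bivariate normal vector. -/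
lemma charFun_map_mul_of_isBivariateNormal {Ω : Type*} [MeasurableSpace Ω] {X Y : Ω → ℝ}
    {Q : Measure Ω} {μX μY σX σY ρ : ℝ} (hσX : 0 < σX) (hσY : 0 < σY) (hρ : ρ ∈ Ioo (-1 : ℝ) 1)
    (hXY : IsBivariateNormal X Y μX μY σX σY ρ Q) {r₁ r₂ κ₁ κ₂ : ℝ}
    (hr₁ : r₁ = 1 / (σX * σY * (1 + ρ))) (hr₂ : r₂ = 1 / (σX * σY * (1 - ρ)))
    (hκ₁ : κ₁ = (μX / σX + μY / σY) ^ 2 / (4 * (1 + ρ)))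
    (hκ₂ : κ₂ = (μX / σX - μY / σY) ^ 2 / (4 * (1 - ρ))) (t : ℝ) :
    charFun (Q.map fun ω => X ω * Y ω) t
      = (((r₁ ^ (1 / 2 : ℝ) : ℝ) : ℂ) * (r₁ - t * Complex.I) ^ (-(1 / 2 : ℂ))
          * Complex.exp (κ₁ * (r₁ / (r₁ - t * Complex.I)) - κ₁))
        * (((r₂ ^ (1 / 2 : ℝ) : ℝ) : ℂ) * (r₂ + t * Complex.I) ^ (-(1 / 2 : ℂ))
          * Complex.exp (κ₂ * (r₂ / (r₂ + t * Complex.I)) - κ₂)) := by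
  have h1 : 0 < 1 + ρ := by linarith [hρ.1]
  have h2 : 0 < 1 - ρ := by linarith [hρ.2]
  have hs : 0 < σX * σY := mul_pos hσX hσY
  have hr₁0 : 0 < r₁ := by rw [hr₁]; positivity
  have hr₂0 : 0 < r₂ := by rw [hr₂]; positivity
  set S := √(σX * σY) with hS
  have hS0 : 0 < S := Real.sqrt_pos.2 hs
  have hS2 : S ^ 2 = σX * σY := Real.sq_sqrt hs.le
  let v₁ : NNReal := ⟨σX * σY * (1 + ρ) / 2, by positivity⟩
  let v₂ : NNReal := ⟨σX * σY * (1 - ρ) / 2, by positivity⟩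
  have hv₁ : (v₁ : ℝ) = 1 / (2 * r₁) := by
    rw [hr₁]
    change σX * σY * (1 + ρ) / 2 = _
    field_simp
  have hv₂ : (v₂ : ℝ) = 1 / (2 * r₂) := by
    rw [hr₂]
    change σX * σY * (1 - ρ) / 2 = _
    field_simp
  have hlaw := hXY.map_eq
  rw [multivariateGaussian_eq_map_prod μX μY hσX hσY hρ (v₁ := v₁) (v₂ := v₂) rfl rfl] at hlaw
  have hmeas : Measurable fun q : ℝ × ℝ => !₂[σX * (q.1 + q.2) / S, σY * (q.1 - q.2) / S] := by
    refine (WithLp.measurable_toLp 2 _).comp ?_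
    refine measurable_pi_lambda _ fun i => ?_
    fin_cases i <;> simp <;> fun_prop
  have hprod : Measurable fun x : EuclideanSpace ℝ (Fin 2) => x 0 * x 1 := by fun_prop
  have hmap : Q.map (fun ω => X ω * Y ω)
      = ((gaussianReal ((μX / σX + μY / σY) * S / 2) v₁).prod
          (gaussianReal ((μX / σX - μY / σY) * S / 2) v₂)).map fun q => q.1 ^ 2 - q.2 ^ 2 := by
    have hc : (fun ω => X ω * Y ω)
        = (fun x : EuclideanSpace ℝ (Fin 2) => x 0 * x 1) ∘ fun ω => !₂[X ω, Y ω] := by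
      ext ω
      simp
    rw [hc, ← AEMeasurable.map_map_of_aemeasurable hprod.aemeasurable hXY.aemeasurable, hlaw,
      Measure.map_map hprod hmeas]
    congr 1
    ext q
    simp only [Function.comp_apply, Matrix.cons_val_zero, Matrix.cons_val_one]
    have : σX * (q.1 + q.2) / S * (σY * (q.1 - q.2) / S)
        = σX * σY * (q.1 ^ 2 - q.2 ^ 2) / S ^ 2 := by ring
    rw [this, hS2]
    field_simp
  rw [hmap, charFun_apply_real, integral_map (by fun_prop) (by fun_prop)]
  -- The frequency enters as `w = r₁ - it` for the first square and, because of the minus sign, as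
  -- `w = r₂ + it` for the second.
  have e : ∀ q : ℝ × ℝ, Complex.exp (t * ((q.1 ^ 2 - q.2 ^ 2 : ℝ) : ℂ) * Complex.I)
      = Complex.exp ((r₁ - (r₁ - t * Complex.I)) * (q.1 : ℂ) ^ 2)
        * Complex.exp ((r₂ - (r₂ + t * Complex.I)) * (q.2 : ℂ) ^ 2) := by
    intro q
    rw [← Complex.exp_add]
    congr 1
    push_cast
    ring
  simp_rw [e]
  rw [integral_prod_mul (fun p : ℝ => Complex.exp ((r₁ - (r₁ - t * Complex.I)) * (p : ℂ) ^ 2))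
      (fun p : ℝ => Complex.exp ((r₂ - (r₂ + t * Complex.I)) * (p : ℂ) ^ 2)),
    integral_cexp_sq_gaussianReal hr₁0 hv₁ (by simp),
    integral_cexp_sq_gaussianReal hr₂0 hv₂ (by simp)]
  have k₁ : r₁ * ((μX / σX + μY / σY) * S / 2) ^ 2 = κ₁ := by
    rw [div_pow, mul_pow, hS2, hr₁, hκ₁]
    field_simp
    ring
  have k₂ : r₂ * ((μX / σX - μY / σY) * S / 2) ^ 2 = κ₂ := by
    rw [div_pow, mul_pow, hS2, hr₂, hκ₂]
    field_simp
    ring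
  rw [k₁, k₂]

/-- Taking powers multiplies the shape and the Poisson parameter. -/
lemma pow_gammaMixture_transform {n : ℕ} {r κ : ℝ} (hr : 0 < r) (w : ℂ) :
    (((r ^ (1 / 2 : ℝ) : ℝ) : ℂ) * w ^ (-(1 / 2 : ℂ)) * Complex.exp (κ * (r / w) - κ)) ^ n
      = ((r ^ ((n : ℝ) / 2) : ℝ) : ℂ) * w ^ (-(((n : ℝ) / 2 : ℝ) : ℂ))
        * Complex.exp (((n * κ : ℝ) : ℂ) * (r / w) - ((n * κ : ℝ) : ℂ)) := by
  rw [mul_pow, mul_pow, ← Complex.ofReal_pow, ← Real.rpow_natCast, ← Real.rpow_mul hr.le,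
    ← Complex.cpow_nat_mul, ← Complex.exp_nat_mul]
  congr 2
  · congr 2
    ring
  · congr 1
    push_cast
    ring
  · push_cast
    ring

/-- The law of a sum of independent copies of a product of correlated normal variables. -/
lemma map_sum_eq_withDensity {Ω Ω' : Type*} [MeasurableSpace Ω] [MeasurableSpace Ω']
    (P : Measure Ω) [IsProbabilityMeasure P] (Q : Measure Ω')
    {μX μY σX σY ρ : ℝ} (hσX : 0 < σX) (hσY : 0 < σY) (hρ : ρ ∈ Ioo (-1 : ℝ) 1)
    {X Y : Ω' → ℝ} (hXY : IsBivariateNormal X Y μX μY σX σY ρ Q)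
    {n : ℕ} (hn : 1 ≤ n) {Z : Fin n → Ω → ℝ} (hindep : iIndepFun Z P)
    (hZ : ∀ i, IdentDistrib (Z i) (fun ω => X ω * Y ω) P Q) {r₁ r₂ κ₁ κ₂ : ℝ}
    (hr₁ : r₁ = 1 / (σX * σY * (1 + ρ))) (hr₂ : r₂ = 1 / (σX * σY * (1 - ρ)))
    (hκ₁ : κ₁ = (μX / σX + μY / σY) ^ 2 / (4 * (1 + ρ)))
    (hκ₂ : κ₂ = (μX / σX - μY / σY) ^ 2 / (4 * (1 - ρ))) :
    P.map (fun ω => ∑ i, Z i ω)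
      = (volume.withDensity fun y => ENNReal.ofReal (gammaMixture (n / 2) r₁ (n * κ₁) y))
        ∗ (volume.withDensity fun y => ENNReal.ofReal (gammaMixture (n / 2) r₂ (n * κ₂) (-y))) := by
  have h1 : 0 < 1 + ρ := by linarith [hρ.1]
  have h2 : 0 < 1 - ρ := by linarith [hρ.2]
  have hs : 0 < σX * σY := mul_pos hσX hσY
  have hr₁0 : 0 < r₁ := by rw [hr₁]; positivity
  have hr₂0 : 0 < r₂ := by rw [hr₂]; positivity
  have hκ₁0 : 0 ≤ n * κ₁ := by rw [hκ₁]; positivity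
  have hκ₂0 : 0 ≤ n * κ₂ := by rw [hκ₂]; positivity
  have hα : (0 : ℝ) < n / 2 := by
    have : (0 : ℝ) < n := by exact_mod_cast hn
    positivity
  have hm₁ := measurable_gammaMixture (r := r₁) (κ := n * κ₁) hα
  have hm₂ : Measurable fun y => gammaMixture (n / 2) r₂ (n * κ₂) (-y) :=
    (measurable_gammaMixture hα).comp measurable_neg
  have hi₁ := integrable_gammaMixture hα hr₁0 hκ₁0
  have hi₂ := (integrable_gammaMixture hα hr₂0 hκ₂0).comp_neg
  have hn₁ := gammaMixture_nonneg hα hr₁0 hκ₁0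
  have hn₂ := gammaMixture_nonneg hα hr₂0 hκ₂0
  have : IsFiniteMeasure
      (volume.withDensity fun y => ENNReal.ofReal (gammaMixture (n / 2) r₁ (n * κ₁) y)) :=
    isFiniteMeasure_withDensity_ofReal hi₁.2
  have : IsFiniteMeasure
      (volume.withDensity fun y => ENNReal.ofReal (gammaMixture (n / 2) r₂ (n * κ₂) (-y))) :=
    isFiniteMeasure_withDensity_ofReal hi₂.2
  have hZm : ∀ i, AEMeasurable (Z i) P := fun i => (hZ i).aemeasurable_fst
  refine Measure.ext_of_charFun (funext fun t => ?_)
  rw [hindep.charFun_map_fun_sum_eq_prod hZm, Finset.prod_apply]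
  simp_rw [fun i => (hZ i).map_eq]
  rw [Finset.prod_const, Finset.card_univ, Fintype.card_fin,
    charFun_map_mul_of_isBivariateNormal hσX hσY hρ hXY hr₁ hr₂ hκ₁ hκ₂, mul_pow,
    pow_gammaMixture_transform hr₁0, pow_gammaMixture_transform hr₂0, charFun_conv,
    charFun_withDensity_ofReal hm₁ hn₁, charFun_withDensity_ofReal hm₂ fun y => hn₂ _]
  congr 1
  · rw [← integral_gammaMixture_mul_cexp hα hr₁0 hκ₁0 (by simp)]
    congr 1
    ext y
    ring_nf
  · rw [← integral_gammaMixture_mul_cexp hα hr₂0 hκ₂0 (by simp), ← integral_neg_eq_self]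
    congr 1
    ext y
    push_cast
    ring_nf

/-! ### Densities of differences. -/

/-- The density of the difference of two independent variables with densities `g₁` and `g₂`. -/
def diffDensity (g₁ g₂ : ℝ → ℝ) (x : ℝ) : ℝ := ∫ y, g₁ y * g₂ (y - x)

lemma diffDensity_eq_integral_add (g₁ g₂ : ℝ → ℝ) (x : ℝ) :
    diffDensity g₁ g₂ x = ∫ y, g₁ (y + x) * g₂ y := by
  rw [diffDensity, ← integral_add_right_eq_self _ x]
  simp

lemma diffDensity_neg (g₁ g₂ : ℝ → ℝ) (x : ℝ) :
    diffDensity g₁ g₂ (-x) = diffDensity g₂ g₁ x := by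
  rw [diffDensity_eq_integral_add, diffDensity]
  simp_rw [mul_comm (g₂ _), sub_eq_add_neg]

lemma measurable_diffDensity {g₁ g₂ : ℝ → ℝ} (h₁ : Measurable g₁) (h₂ : Measurable g₂) :
    Measurable (diffDensity g₁ g₂) := by
  have h : StronglyMeasurable (Function.uncurry fun x y : ℝ => g₁ y * g₂ (y - x)) :=
    Measurable.stronglyMeasurable (by
      simp only [Function.uncurry_def]
      fun_prop)
  exact h.integral_prod_right.measurable

lemma conv_withDensity_eq_diffDensity {g₁ g₂ : ℝ → ℝ} (h₁ : Measurable g₁) (h₂ : Measurable g₂)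
    (hg₁ : ∀ y, 0 ≤ g₁ y) (hg₂ : ∀ y, 0 ≤ g₂ y)
    (hint : ∀ x, x ≠ 0 → Integrable fun y => g₁ y * g₂ (y - x)) :
    (volume.withDensity fun y => ENNReal.ofReal (g₁ y))
        ∗ (volume.withDensity fun y => ENNReal.ofReal (g₂ (-y)))
      = volume.withDensity fun x => ENNReal.ofReal (diffDensity g₁ g₂ x) := by
  rw [conv_withDensity_eq_lconvolution (by fun_prop) (by fun_prop)]
  refine withDensity_congr_ae ?_
  -- The origin is a null set and has to be left out: for `n = 1` both densities can behave like
  -- `y^(-1/2)` near `0`, and their product is then not integrable.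
  filter_upwards [Measure.ae_ne volume (0 : ℝ)] with x hx
  rw [diffDensity, ofReal_integral_eq_lintegral_ofReal (hint x hx)
    (ae_of_all _ fun y => mul_nonneg (hg₁ _) (hg₂ _)), lconvolution_def]
  refine lintegral_congr fun y => ?_
  rw [ENNReal.ofReal_mul (hg₁ _)]
  congr 3
  ring

/-! ### Differences of two mixtures: integrability, continuity, limits. -/

section gammaMixture

variable {α r₁ r₂ κ₁ κ₂ : ℝ}

/-- On the support `y > 0` of the second factor the first is evaluated beyond `x`, away from its
singularity, so it is bounded while the second is integrable. -/
lemma integrable_gammaMixture_add_mul (hα : 0 < α) (hr₁ : 0 < r₁) (hr₂ : 0 < r₂) (hκ₁ : 0 ≤ κ₁)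
    (hκ₂ : 0 ≤ κ₂) {x : ℝ} (hx : 0 < x) :
    Integrable fun y => gammaMixture α r₁ κ₁ (y + x) * gammaMixture α r₂ κ₂ y := by
  obtain ⟨C, hC⟩ := exists_gammaMixture_le hα hr₁ hκ₁ hx
  have hm₁ := measurable_gammaMixture (r := r₁) (κ := κ₁) hα
  have hm₂ := measurable_gammaMixture (r := r₂) (κ := κ₂) hα
  refine ((integrable_gammaMixture hα hr₂ hκ₂).const_mul C).mono' (by fun_prop)
    (ae_of_all _ fun y => ?_)
  have h₁ := gammaMixture_nonneg hα hr₁ hκ₁ (y + x)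
  have h₂ := gammaMixture_nonneg hα hr₂ hκ₂ y
  rw [Real.norm_of_nonneg (mul_nonneg h₁ h₂)]
  rcases le_or_gt y 0 with hy | hy
  · simp [gammaMixture_of_nonpos hy]
  · exact mul_le_mul_of_nonneg_right (hC _ (by linarith)) h₂

lemma integrable_gammaMixture_mul_sub (hα : 0 < α) (hr₁ : 0 < r₁) (hr₂ : 0 < r₂) (hκ₁ : 0 ≤ κ₁)
    (hκ₂ : 0 ≤ κ₂) {x : ℝ} (hx : x ≠ 0) :
    Integrable fun y => gammaMixture α r₁ κ₁ y * gammaMixture α r₂ κ₂ (y - x) := by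
  rcases lt_or_gt_of_ne hx with hx | hx
  · have h := integrable_gammaMixture_add_mul hα hr₂ hr₁ hκ₂ hκ₁ (x := -x) (by linarith)
    simpa only [mul_comm, sub_eq_add_neg] using h
  · have h := (integrable_gammaMixture_add_mul hα hr₁ hr₂ hκ₁ hκ₂ hx).comp_sub_right x
    simpa using h

lemma continuousAt_diffDensity_gammaMixture (hα : 0 < α) (hr₁ : 0 < r₁) (hr₂ : 0 < r₂)
    (hκ₁ : 0 ≤ κ₁) (hκ₂ : 0 ≤ κ₂) {x : ℝ} (hx : 0 < x) :
    ContinuousAt (diffDensity (gammaMixture α r₁ κ₁) (gammaMixture α r₂ κ₂)) x := by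
  -- A bound beyond `x / 2` is uniform over all shifts `z > x / 2`, a neighbourhood of `x`.
  obtain ⟨C, hC⟩ := exists_gammaMixture_le hα hr₁ hκ₁ (half_pos hx)
  have hm₁ := measurable_gammaMixture (r := r₁) (κ := κ₁) hα
  have hm₂ := measurable_gammaMixture (r := r₂) (κ := κ₂) hα
  rw [funext (diffDensity_eq_integral_add (gammaMixture α r₁ κ₁) (gammaMixture α r₂ κ₂))]
  refine continuousAt_of_dominated (bound := fun y => C * gammaMixture α r₂ κ₂ y)
    (Eventually.of_forall fun z => by fun_prop) ?_
    ((integrable_gammaMixture hα hr₂ hκ₂).const_mul C) (ae_of_all _ fun y => ?_)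
  · filter_upwards [Ioi_mem_nhds (half_lt_self hx)] with z hz
    refine ae_of_all _ fun y => ?_
    have hz' : x / 2 < z := hz
    have h₁ := gammaMixture_nonneg hα hr₁ hκ₁ (y + z)
    have h₂ := gammaMixture_nonneg hα hr₂ hκ₂ y
    rw [Real.norm_of_nonneg (mul_nonneg h₁ h₂)]
    rcases le_or_gt y 0 with hy | hy
    · simp [gammaMixture_of_nonpos hy]
    · exact mul_le_mul_of_nonneg_right (hC _ (by linarith)) h₂
  · rcases le_or_gt y 0 with hy | hy
    · simp only [gammaMixture_of_nonpos hy, mul_zero]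
      exact continuousAt_const
    · have h := continuousAt_gammaMixture (r := r₁) (κ := κ₁) hα (y := y + x) (by linarith)
      exact (ContinuousAt.comp (f := fun z => y + z) h (by fun_prop)).mul continuousAt_const

lemma continuousOn_diffDensity_gammaMixture (hα : 0 < α) (hr₁ : 0 < r₁) (hr₂ : 0 < r₂)
    (hκ₁ : 0 ≤ κ₁) (hκ₂ : 0 ≤ κ₂) :
    ContinuousOn (diffDensity (gammaMixture α r₁ κ₁) (gammaMixture α r₂ κ₂)) {0}ᶜ := by
  intro x hx
  refine ContinuousAt.continuousWithinAt ?_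
  rcases lt_or_gt_of_ne (show x ≠ 0 from hx) with hx | hx
  · have h := continuousAt_diffDensity_gammaMixture hα hr₂ hr₁ hκ₂ hκ₁ (x := -x) (by linarith)
    have h' : diffDensity (gammaMixture α r₁ κ₁) (gammaMixture α r₂ κ₂)
        = diffDensity (gammaMixture α r₂ κ₂) (gammaMixture α r₁ κ₁) ∘ Neg.neg := by
      ext z
      simp [diffDensity_neg]
    rw [h']
    exact h.comp continuousAt_neg
  · exact continuousAt_diffDensity_gammaMixture hα hr₁ hr₂ hκ₁ hκ₂ hx

/-- The Poisson parameters are quadratic in the means, hence the scaling by `m²`. For `|m| ≤ 1` they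
stay below `κ₁` and `κ₂`, so dominated convergence applies. -/
lemma tendsto_diffDensity_gammaMixture (hα : 0 < α) (hr₁ : 0 < r₁) (hr₂ : 0 < r₂)
    (hκ₁ : 0 ≤ κ₁) (hκ₂ : 0 ≤ κ₂) {x : ℝ} (hx : 0 < x) :
    Tendsto (fun m : ℝ => diffDensity (gammaMixture α r₁ (κ₁ * m ^ 2))
      (gammaMixture α r₂ (κ₂ * m ^ 2)) x) (𝓝 0)
      (𝓝 (diffDensity (gammaMixture α r₁ 0) (gammaMixture α r₂ 0) x)) := by
  simp_rw [diffDensity_eq_integral_add]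
  have hm₁ := fun κ => measurable_gammaMixture (r := r₁) (κ := κ) hα
  have hm₂ := fun κ => measurable_gammaMixture (r := r₂) (κ := κ) hα
  refine tendsto_integral_filter_of_dominated_convergence
    (fun y => Real.exp κ₁ * Real.exp κ₂
      * (gammaMixture α r₁ κ₁ (y + x) * gammaMixture α r₂ κ₂ y))
    (Eventually.of_forall fun m => ?_) ?_
    ((integrable_gammaMixture_add_mul hα hr₁ hr₂ hκ₁ hκ₂ hx).const_mul _)
    (ae_of_all _ fun y => ?_)
  · have := hm₁ (κ₁ * m ^ 2)
    have := hm₂ (κ₂ * m ^ 2)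
    fun_prop
  · filter_upwards [Icc_mem_nhds (show (-1 : ℝ) < 0 by norm_num) one_pos] with m hm
    refine ae_of_all _ fun y => ?_
    have hm2 : m ^ 2 ≤ 1 := by nlinarith [hm.1, hm.2]
    have k₁ : κ₁ * m ^ 2 ≤ κ₁ := mul_le_of_le_one_right hκ₁ hm2
    have k₂ : κ₂ * m ^ 2 ≤ κ₂ := mul_le_of_le_one_right hκ₂ hm2
    have p₁ : 0 ≤ κ₁ * m ^ 2 := by positivity
    have p₂ : 0 ≤ κ₂ * m ^ 2 := by positivity
    have h₁ := gammaMixture_nonneg hα hr₁ p₁ (y + x)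
    have h₂ := gammaMixture_nonneg hα hr₂ p₂ y
    have h₁' := gammaMixture_nonneg hα hr₁ hκ₁ (y + x)
    rw [Real.norm_of_nonneg (mul_nonneg h₁ h₂)]
    calc _ ≤ (Real.exp κ₁ * gammaMixture α r₁ κ₁ (y + x))
          * (Real.exp κ₂ * gammaMixture α r₂ κ₂ y) :=
        mul_le_mul (gammaMixture_le_exp_mul hα hr₁ p₁ k₁ _)
          (gammaMixture_le_exp_mul hα hr₂ p₂ k₂ _) h₂ (by positivity)
      _ = _ := by ring
  · have c₁ := continuous_gammaMixture_param (r := r₁) hα (y + x)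
    have c₂ := continuous_gammaMixture_param (r := r₂) hα y
    have h : Continuous fun m : ℝ => gammaMixture α r₁ (κ₁ * m ^ 2) (y + x)
        * gammaMixture α r₂ (κ₂ * m ^ 2) y :=
      (c₁.comp (by fun_prop : Continuous fun m : ℝ => κ₁ * m ^ 2)).mul
        (c₂.comp (by fun_prop : Continuous fun m : ℝ => κ₂ * m ^ 2))
    simpa using h.tendsto 0

/-- An integral formula for the density of a difference follows from a pointwise identity. -/
lemma eqIntegral_diffDensity_gammaMixture (hα : 0 < α) (hr₁ : 0 < r₁) (hr₂ : 0 < r₂)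
    (hκ₁ : 0 ≤ κ₁) (hκ₂ : 0 ≤ κ₂) {x : ℝ} (hx : 0 < x) {D : ℝ} (hD : D ≠ 0) {g : ℝ → ℝ}
    (hg : ∀ t, 0 < t →
      D * g t = x * (gammaMixture α r₁ κ₁ (x * (t + 1)) * gammaMixture α r₂ κ₂ (x * t))) :
    EqIntegral (diffDensity (gammaMixture α r₁ κ₁) (gammaMixture α r₂ κ₂) x) D g := by
  set h : ℝ → ℝ := fun y => gammaMixture α r₁ κ₁ (y + x) * gammaMixture α r₂ κ₂ y with hh
  have hint : IntegrableOn h (Ioi 0) :=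
    (integrable_gammaMixture_add_mul hα hr₁ hr₂ hκ₁ hκ₂ hx).integrableOn
  -- Since `D ≠ 0`, the integrand `g` itself is recovered from the pointwise identity, and its
  -- integrability is inherited from the mixtures under `y = x t`.
  have hgt : ∀ t ∈ Ioi (0 : ℝ), D⁻¹ * (x * h (x * t)) = g t := by
    intro t ht
    have e : x * t + x = x * (t + 1) := by ring
    rw [hh]
    simp only
    rw [e, ← hg t ht, inv_mul_cancel_left₀ hD]
  have hscale : IntegrableOn (fun t => h (x * t)) (Ioi 0) := by
    rw [integrableOn_Ioi_comp_mul_left_iff _ _ hx, mul_zero]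
    exact hint
  refine ⟨IntegrableOn.congr_fun ((hscale.const_mul x).const_mul D⁻¹) hgt measurableSet_Ioi, ?_⟩
  rw [← setIntegral_congr_fun measurableSet_Ioi hgt, integral_const_mul, integral_const_mul,
    mul_inv_cancel_left₀ hD, integral_comp_mul_left_Ioi h 0 hx, mul_zero, smul_eq_mul,
    mul_inv_cancel_left₀ hx.ne', diffDensity_eq_integral_add]
  refine (setIntegral_eq_integral_of_forall_compl_eq_zero fun y hy => ?_).symm
  simp [gammaMixture_of_nonpos (α := α) (r := r₂) (κ := κ₂) (y := y) (by simpa using hy)]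

lemma gammaMixture_eq_besselI {r κ y z : ℝ} (hy : 0 < y) (hz : 0 < z)
    (hzy : z ^ 2 / 4 = κ * r * y) :
    gammaMixture α r κ y = r ^ α * Real.exp (-κ) * y ^ (α - 1) * Real.exp (-(r * y))
      * (z / 2) ^ (1 - α) * besselI (α - 1) z := by
  have hz2 : 0 < z / 2 := by positivity
  rw [gammaMixture_of_pos hy, besselI_eq hz, hzy, show 1 - α = -(α - 1) by ring,
    Real.rpow_neg hz2.le]
  have : (z / 2) ^ (α - 1) ≠ 0 := (Real.rpow_pos_of_pos hz2 _).ne'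
  field_simp

lemma gammaMixture_zero {r y : ℝ} (hy : 0 < y) :
    gammaMixture α r 0 y = r ^ α * y ^ (α - 1) * Real.exp (-(r * y)) / Real.Gamma α := by
  rw [gammaMixture_of_pos hy]
  simp [besselSeries_zero]
  ring

end gammaMixture

/-! ### Matching the prefactors and integrands. -/

section formulas

variable {N s p q A B x t : ℝ}

/-- Both sides are positive products of real powers, so taking logarithms reduces the claim to a
polynomial identity in the logarithms. -/
lemma rpow_prefactor_general (hN : 0 < N) (hs : 0 < s) (hp : 0 < p) (hq : 0 < q) (hA : 0 < A)
    (hB : 0 < B) (hx : 0 < x) (ht : 0 < t) :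
    1 / (s * (p * q)) * (N / 4) ^ (1 - N / 2) * (A * B) ^ (1 - N / 2) * (x / s) ^ (N / 2)
        * (t * (t + 1)) ^ ((N - 2) / 4)
      = x * ((1 / (s * p)) ^ (N / 2) * (x * (t + 1)) ^ (N / 2 - 1)
          * (A * (√(N * x * (t + 1)) / (p * √s)) / 2) ^ (1 - N / 2))
        * ((1 / (s * q)) ^ (N / 2) * (x * t) ^ (N / 2 - 1)
          * (B * (√(N * x * t) / (q * √s)) / 2) ^ (1 - N / 2)) := by
  have h4 : Real.log 4 = 2 * Real.log 2 := by
    rw [show (4 : ℝ) = 2 ^ 2 by norm_num, Real.log_pow]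
    norm_num
  refine Real.log_injOn_pos (mem_Ioi.2 (by positivity)) (mem_Ioi.2 (by positivity)) ?_
  simp (disch := positivity) only [Real.log_mul, Real.log_rpow, Real.log_div, Real.log_sqrt,
    Real.log_one, h4]
  ring

lemma rpow_prefactor_zero_right (hN : 0 < N) (hs : 0 < s) (hp : 0 < p) (hq : 0 < q) (hA : 0 < A)
    (hx : 0 < x) (ht : 0 < t) :
    N ^ ((2 - N) / 4) / (s * q ^ (N / 2) * p) * A ^ (1 - N / 2) * (x / s) ^ ((3 * N - 2) / 4)
        * (t ^ 2 * (t + 1)) ^ ((N - 2) / 4)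
      = x * ((1 / (s * p)) ^ (N / 2) * (x * (t + 1)) ^ (N / 2 - 1)
          * (2 * A * (√(N * x * (t + 1)) / (p * √s)) / 2) ^ (1 - N / 2))
        * ((1 / (s * q)) ^ (N / 2) * (x * t) ^ (N / 2 - 1)) := by
  refine Real.log_injOn_pos (mem_Ioi.2 (by positivity)) (mem_Ioi.2 (by positivity)) ?_
  simp (disch := positivity) only [Real.log_mul, Real.log_rpow, Real.log_div, Real.log_sqrt,
    Real.log_one, Real.log_pow]
  push_cast
  ring

lemma rpow_prefactor_zero_left (hN : 0 < N) (hs : 0 < s) (hp : 0 < p) (hq : 0 < q) (hA : 0 < A)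
    (hx : 0 < x) (ht : 0 < t) :
    N ^ ((2 - N) / 4) / (s * p ^ (N / 2) * q) * A ^ (1 - N / 2) * (x / s) ^ ((3 * N - 2) / 4)
        * ((t + 1) ^ 2 * t) ^ ((N - 2) / 4)
      = x * ((1 / (s * p)) ^ (N / 2) * (x * (t + 1)) ^ (N / 2 - 1))
        * ((1 / (s * q)) ^ (N / 2) * (x * t) ^ (N / 2 - 1)
          * (2 * A * (√(N * x * t) / (q * √s)) / 2) ^ (1 - N / 2)) := by
  refine Real.log_injOn_pos (mem_Ioi.2 (by positivity)) (mem_Ioi.2 (by positivity)) ?_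
  simp (disch := positivity) only [Real.log_mul, Real.log_rpow, Real.log_div, Real.log_sqrt,
    Real.log_one, Real.log_pow]
  push_cast
  ring

/-- The argument of the Bessel function, in terms of the parameters of the mixture. -/
lemma sq_bessel_arg (hN : 0 < N) (hs : 0 < s) (hp : 0 < p) {y : ℝ} (hy : 0 < y) :
    (A * (√(N * y) / (p * √s))) ^ 2 / 4 = N * (A ^ 2 / (4 * p)) * (1 / (s * p)) * y := by
  rw [mul_pow, div_pow, mul_pow, Real.sq_sqrt (by positivity), Real.sq_sqrt hs.le]
  field_simp

end formulas

variable {n : ℕ} {μX μY σX σY ρ x t : ℝ}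

lemma D₁_mul_integrand₁ (hn : 1 ≤ n) (hσX : 0 < σX) (hσY : 0 < σY) (hρ : ρ ∈ Ioo (-1 : ℝ) 1)
    (hne : |μX| / σX ≠ |μY| / σY) (hx : 0 < x) (ht : 0 < t) :
    D₁ n μX μY σX σY ρ x * integrand₁ n μX μY σX σY ρ x t
      = x * (gammaMixture (n / 2) (1 / (σX * σY * (1 + ρ)))
          (n * ((μX / σX + μY / σY) ^ 2 / (4 * (1 + ρ)))) (x * (t + 1))
        * gammaMixture (n / 2) (1 / (σX * σY * (1 - ρ)))
          (n * ((μX / σX - μY / σY) ^ 2 / (4 * (1 - ρ)))) (x * t)) := by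
  have hN : (0 : ℝ) < n := by exact_mod_cast hn
  have hp : 0 < 1 + ρ := by linarith [hρ.1]
  have hq : 0 < 1 - ρ := by linarith [hρ.2]
  have hs : 0 < σX * σY := mul_pos hσX hσY
  have hab : |μX / σX| ≠ |μY / σY| := by
    rwa [abs_div, abs_div, abs_of_pos hσX, abs_of_pos hσY]
  have hA : 0 < |μX / σX + μY / σY| := by
    rw [abs_pos]
    intro h
    exact hab (by rw [eq_neg_of_add_eq_zero_left h, abs_neg])
  have hB : 0 < |μX / σX - μY / σY| := by
    rw [abs_pos]
    intro h
    exact hab (by rw [sub_eq_zero.1 h])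
  have hz₁ : 0 < |μX / σX + μY / σY| * (√(n * (x * (t + 1))) / ((1 + ρ) * √(σX * σY))) := by
    positivity
  have hz₂ : 0 < |μX / σX - μY / σY| * (√(n * (x * t)) / ((1 - ρ) * √(σX * σY))) := by
    positivity
  have hpow := rpow_prefactor_general hN hs hp hq hA hB hx ht
  have hAB : |μX ^ 2 / σX ^ 2 - μY ^ 2 / σY ^ 2|
      = |μX / σX + μY / σY| * |μX / σX - μY / σY| := by
    rw [← abs_mul]
    congr 1
    ring
  have hpq : 1 - ρ ^ 2 = (1 + ρ) * (1 - ρ) := by ring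
  -- The exponent linear in `t` comes from `r₁ + r₂ = 2 / (σX σY (1 - ρ²))`; the shift `t + 1` in
  -- the first factor contributes `r₁ x` to the prefactor.
  have hexp : Real.exp (-((n : ℝ) / (2 * (1 - ρ ^ 2))
          * (μX ^ 2 / σX ^ 2 + μY ^ 2 / σY ^ 2 - 2 * ρ * μX * μY / (σX * σY)))
        - x / (σX * σY * (1 + ρ))) * Real.exp (-(2 * x * t / (σX * σY * (1 - ρ ^ 2))))
      = Real.exp (-(n * ((μX / σX + μY / σY) ^ 2 / (4 * (1 + ρ)))))
        * Real.exp (-(1 / (σX * σY * (1 + ρ)) * (x * (t + 1))))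
        * Real.exp (-(n * ((μX / σX - μY / σY) ^ 2 / (4 * (1 - ρ)))))
        * Real.exp (-(1 / (σX * σY * (1 - ρ)) * (x * t))) := by
    simp only [← Real.exp_add]
    congr 1
    rw [hpq]
    field_simp
    ring
  rw [gammaMixture_eq_besselI (by positivity) hz₁
      (by rw [sq_bessel_arg hN hs hp (by positivity), sq_abs]),
    gammaMixture_eq_besselI (by positivity) hz₂
      (by rw [sq_bessel_arg hN hs hq (by positivity), sq_abs]), D₁, integrand₁, hAB,
    add_comm 1 t, mul_assoc (n : ℝ) x (t + 1), mul_assoc (n : ℝ) x t]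
  rw [mul_assoc (n : ℝ) x (t + 1), mul_assoc (n : ℝ) x t, ← hpq] at hpow
  set I₁ := besselI _ (|μX / σX + μY / σY| * _)
  set I₂ := besselI _ (|μX / σX - μY / σY| * _)
  -- The powers are exchanged first, with exponentials and Bessel factors carried along, and then
  -- the exponentials.
  linear_combination (Real.exp (-((n : ℝ) / (2 * (1 - ρ ^ 2))
          * (μX ^ 2 / σX ^ 2 + μY ^ 2 / σY ^ 2 - 2 * ρ * μX * μY / (σX * σY)))
        - x / (σX * σY * (1 + ρ))) * Real.exp (-(2 * x * t / (σX * σY * (1 - ρ ^ 2))))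
          * I₁ * I₂) * hpow
    + (x * ((1 / (σX * σY * (1 + ρ))) ^ ((n : ℝ) / 2) * (x * (t + 1)) ^ ((n : ℝ) / 2 - 1)
          * (|μX / σX + μY / σY| * (√(n * (x * (t + 1))) / ((1 + ρ) * √(σX * σY))) / 2)
            ^ (1 - (n : ℝ) / 2))
        * ((1 / (σX * σY * (1 - ρ))) ^ ((n : ℝ) / 2) * (x * t) ^ ((n : ℝ) / 2 - 1)
          * (|μX / σX - μY / σY| * (√(n * (x * t)) / ((1 - ρ) * √(σX * σY))) / 2)
            ^ (1 - (n : ℝ) / 2)) * I₁ * I₂) * hexp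

lemma D₂_mul_integrand₂ (hn : 1 ≤ n) (hσX : 0 < σX) (hσY : 0 < σY) (hρ : ρ ∈ Ioo (-1 : ℝ) 1)
    (hμX : μX ≠ 0) (hx : 0 < x) (ht : 0 < t) :
    D₂ n μX σX σY ρ x * integrand₂ n μX σX σY ρ x t
      = x * (gammaMixture (n / 2) (1 / (σX * σY * (1 + ρ)))
          (n * ((2 * (|μX| / σX)) ^ 2 / (4 * (1 + ρ)))) (x * (t + 1))
        * gammaMixture (n / 2) (1 / (σX * σY * (1 - ρ))) 0 (x * t)) := by
  have hN : (0 : ℝ) < n := by exact_mod_cast hn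
  have hp : 0 < 1 + ρ := by linarith [hρ.1]
  have hq : 0 < 1 - ρ := by linarith [hρ.2]
  have hs : 0 < σX * σY := mul_pos hσX hσY
  have hA : 0 < |μX| / σX := div_pos (abs_pos.2 hμX) hσX
  have hG : 0 < Real.Gamma ((n : ℝ) / 2) := Real.Gamma_pos_of_pos (by positivity)
  have hz₁ : 0 < 2 * (|μX| / σX) * (√(n * (x * (t + 1))) / ((1 + ρ) * √(σX * σY))) := by
    positivity
  have hpow := rpow_prefactor_zero_right hN hs hp hq hA hx ht
  have hpq : 1 - ρ ^ 2 = (1 + ρ) * (1 - ρ) := by ring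
  have hexp : Real.exp (-((n : ℝ) * μX ^ 2 / (σX ^ 2 * (1 + ρ))) - x / (σX * σY * (1 + ρ)))
        * Real.exp (-(2 * x * t / (σX * σY * (1 - ρ ^ 2))))
      = Real.exp (-(n * ((2 * (|μX| / σX)) ^ 2 / (4 * (1 + ρ)))))
        * Real.exp (-(1 / (σX * σY * (1 + ρ)) * (x * (t + 1))))
        * Real.exp (-(1 / (σX * σY * (1 - ρ)) * (x * t))) := by
    simp only [← Real.exp_add]
    congr 1
    rw [hpq, mul_pow, div_pow, sq_abs]
    field_simp
    ring
  rw [gammaMixture_eq_besselI (by positivity) hz₁ (sq_bessel_arg hN hs hp (by positivity)),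
    gammaMixture_zero (by positivity), D₂, integrand₂,
    add_comm 1 t, mul_assoc (n : ℝ) x (t + 1), mul_div_assoc 2 |μX| σX]
  rw [mul_assoc (n : ℝ) x (t + 1)] at hpow
  set I₁ := besselI _ (2 * (|μX| / σX) * _)
  rw [div_mul_eq_div_div]
  linear_combination (Real.exp (-((n : ℝ) * μX ^ 2 / (σX ^ 2 * (1 + ρ)))
          - x / (σX * σY * (1 + ρ))) * Real.exp (-(2 * x * t / (σX * σY * (1 - ρ ^ 2))))
          * I₁ / Real.Gamma ((n : ℝ) / 2)) * hpow
    + (x * ((1 / (σX * σY * (1 + ρ))) ^ ((n : ℝ) / 2) * (x * (t + 1)) ^ ((n : ℝ) / 2 - 1)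
          * (2 * (|μX| / σX) * (√(n * (x * (t + 1))) / ((1 + ρ) * √(σX * σY))) / 2)
            ^ (1 - (n : ℝ) / 2))
        * ((1 / (σX * σY * (1 - ρ))) ^ ((n : ℝ) / 2) * (x * t) ^ ((n : ℝ) / 2 - 1))
        * I₁ / Real.Gamma ((n : ℝ) / 2)) * hexp

lemma D₃_mul_integrand₃ (hn : 1 ≤ n) (hσX : 0 < σX) (hσY : 0 < σY) (hρ : ρ ∈ Ioo (-1 : ℝ) 1)
    (hμX : μX ≠ 0) (hx : 0 < x) (ht : 0 < t) :
    D₃ n μX σX σY ρ x * integrand₃ n μX σX σY ρ x t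
      = x * (gammaMixture (n / 2) (1 / (σX * σY * (1 + ρ))) 0 (x * (t + 1))
        * gammaMixture (n / 2) (1 / (σX * σY * (1 - ρ)))
          (n * ((2 * (|μX| / σX)) ^ 2 / (4 * (1 - ρ)))) (x * t)) := by
  have hN : (0 : ℝ) < n := by exact_mod_cast hn
  have hp : 0 < 1 + ρ := by linarith [hρ.1]
  have hq : 0 < 1 - ρ := by linarith [hρ.2]
  have hs : 0 < σX * σY := mul_pos hσX hσY
  have hA : 0 < |μX| / σX := div_pos (abs_pos.2 hμX) hσX
  have hG : 0 < Real.Gamma ((n : ℝ) / 2) := Real.Gamma_pos_of_pos (by positivity)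
  have hz₂ : 0 < 2 * (|μX| / σX) * (√(n * (x * t)) / ((1 - ρ) * √(σX * σY))) := by
    positivity
  have hpow := rpow_prefactor_zero_left hN hs hp hq hA hx ht
  have hpq : 1 - ρ ^ 2 = (1 + ρ) * (1 - ρ) := by ring
  have hexp : Real.exp (-((n : ℝ) * μX ^ 2 / (σX ^ 2 * (1 - ρ))) - x / (σX * σY * (1 + ρ)))
        * Real.exp (-(2 * x * t / (σX * σY * (1 - ρ ^ 2))))
      = Real.exp (-(1 / (σX * σY * (1 + ρ)) * (x * (t + 1))))
        * Real.exp (-(n * ((2 * (|μX| / σX)) ^ 2 / (4 * (1 - ρ)))))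
        * Real.exp (-(1 / (σX * σY * (1 - ρ)) * (x * t))) := by
    simp only [← Real.exp_add]
    congr 1
    rw [hpq, mul_pow, div_pow, sq_abs]
    field_simp
    ring
  rw [gammaMixture_eq_besselI (by positivity) hz₂ (sq_bessel_arg hN hs hq (by positivity)),
    gammaMixture_zero (by positivity), D₃, integrand₃,
    mul_assoc (n : ℝ) x t, mul_div_assoc 2 |μX| σX]
  rw [mul_assoc (n : ℝ) x t] at hpow
  set I₂ := besselI _ (2 * (|μX| / σX) * _)
  rw [div_mul_eq_div_div]
  linear_combination (Real.exp (-((n : ℝ) * μX ^ 2 / (σX ^ 2 * (1 - ρ)))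
          - x / (σX * σY * (1 + ρ))) * Real.exp (-(2 * x * t / (σX * σY * (1 - ρ ^ 2))))
          * I₂ / Real.Gamma ((n : ℝ) / 2)) * hpow
    + (x * ((1 / (σX * σY * (1 + ρ))) ^ ((n : ℝ) / 2) * (x * (t + 1)) ^ ((n : ℝ) / 2 - 1))
        * ((1 / (σX * σY * (1 - ρ))) ^ ((n : ℝ) / 2) * (x * t) ^ ((n : ℝ) / 2 - 1)
          * (2 * (|μX| / σX) * (√(n * (x * t)) / ((1 - ρ) * √(σX * σY))) / 2)
            ^ (1 - (n : ℝ) / 2))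
        * I₂ / Real.Gamma ((n : ℝ) / 2)) * hexp

/-! ### The density of the sum and its integral formulas. -/

/-- The density of a sum of `n` independent copies of a product of correlated normal variables. -/
def sumDensity (n : ℕ) (μX μY σX σY ρ : ℝ) : ℝ → ℝ :=
  diffDensity
    (gammaMixture (n / 2) (1 / (σX * σY * (1 + ρ)))
      (n * ((μX / σX + μY / σY) ^ 2 / (4 * (1 + ρ)))))
    (gammaMixture (n / 2) (1 / (σX * σY * (1 - ρ)))
      (n * ((μX / σX - μY / σY) ^ 2 / (4 * (1 - ρ)))))

variable {n : ℕ} {μX μY σX σY ρ x : ℝ}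

/-- Changing the signs of `ρ` and `μY` exchanges the parameters of the two mixtures, and reflecting
`x` exchanges their roles in the difference. -/
lemma sumDensity_eq_neg (n : ℕ) (μX μY σX σY ρ x : ℝ) :
    sumDensity n μX μY σX σY ρ x = sumDensity n μX (-μY) σX σY (-ρ) (-x) := by
  simp only [sumDensity]
  rw [diffDensity_neg, neg_div, ← sub_eq_add_neg, ← sub_eq_add_neg, sub_neg_eq_add, sub_neg_eq_add]

lemma D₁_ne_zero (hn : 1 ≤ n) (hσX : 0 < σX) (hσY : 0 < σY) (hρ : ρ ∈ Ioo (-1 : ℝ) 1)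
    (hne : |μX| / σX ≠ |μY| / σY) (hx : 0 < x) : D₁ n μX μY σX σY ρ x ≠ 0 := by
  have hN : (0 : ℝ) < n := by exact_mod_cast hn
  have hq : 0 < 1 - ρ ^ 2 := by nlinarith [hρ.1, hρ.2]
  have h : 0 < |μX ^ 2 / σX ^ 2 - μY ^ 2 / σY ^ 2| := by
    rw [abs_pos, sub_ne_zero, ← div_pow, ← div_pow, Ne, sq_eq_sq_iff_abs_eq_abs, abs_div, abs_div,
      abs_of_pos hσX, abs_of_pos hσY]
    exact hne
  rw [D₁]
  positivity

lemma D₂_ne_zero (hn : 1 ≤ n) (hσX : 0 < σX) (hσY : 0 < σY) (hρ : ρ ∈ Ioo (-1 : ℝ) 1)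
    (hμX : μX ≠ 0) (hx : 0 < x) : D₂ n μX σX σY ρ x ≠ 0 := by
  have hN : (0 : ℝ) < n := by exact_mod_cast hn
  have hp : 0 < 1 + ρ := by linarith [hρ.1]
  have hq : 0 < 1 - ρ := by linarith [hρ.2]
  have hA : 0 < |μX| := abs_pos.2 hμX
  have hG : 0 < Real.Gamma ((n : ℝ) / 2) := Real.Gamma_pos_of_pos (by positivity)
  rw [D₂]
  positivity

lemma D₃_ne_zero (hn : 1 ≤ n) (hσX : 0 < σX) (hσY : 0 < σY) (hρ : ρ ∈ Ioo (-1 : ℝ) 1)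
    (hμX : μX ≠ 0) (hx : 0 < x) : D₃ n μX σX σY ρ x ≠ 0 := by
  have hN : (0 : ℝ) < n := by exact_mod_cast hn
  have hp : 0 < 1 + ρ := by linarith [hρ.1]
  have hq : 0 < 1 - ρ := by linarith [hρ.2]
  have hA : 0 < |μX| := abs_pos.2 hμX
  have hG : 0 < Real.Gamma ((n : ℝ) / 2) := Real.Gamma_pos_of_pos (by positivity)
  rw [D₃]
  positivity

lemma eqIntegral_sumDensity₁ (hn : 1 ≤ n) (hσX : 0 < σX) (hσY : 0 < σY)
    (hρ : ρ ∈ Ioo (-1 : ℝ) 1) (hne : |μX| / σX ≠ |μY| / σY) (hx : 0 < x) :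
    EqIntegral (sumDensity n μX μY σX σY ρ x) (D₁ n μX μY σX σY ρ x)
      (fun t => integrand₁ n μX μY σX σY ρ x t) := by
  have hN : (0 : ℝ) < n := by exact_mod_cast hn
  have hp : 0 < 1 + ρ := by linarith [hρ.1]
  have hq : 0 < 1 - ρ := by linarith [hρ.2]
  exact eqIntegral_diffDensity_gammaMixture (by positivity) (by positivity) (by positivity)
    (by positivity) (by positivity) hx (D₁_ne_zero hn hσX hσY hρ hne hx)
    fun t ht => D₁_mul_integrand₁ hn hσX hσY hρ hne hx ht

lemma eqIntegral_D₂ (hn : 1 ≤ n) (hσX : 0 < σX) (hσY : 0 < σY) (hρ : ρ ∈ Ioo (-1 : ℝ) 1)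
    (hμX : μX ≠ 0) (hx : 0 < x) :
    EqIntegral (diffDensity
        (gammaMixture (n / 2) (1 / (σX * σY * (1 + ρ)))
          (n * ((2 * (|μX| / σX)) ^ 2 / (4 * (1 + ρ)))))
        (gammaMixture (n / 2) (1 / (σX * σY * (1 - ρ))) 0) x)
      (D₂ n μX σX σY ρ x) (fun t => integrand₂ n μX σX σY ρ x t) := by
  have hN : (0 : ℝ) < n := by exact_mod_cast hn
  have hp : 0 < 1 + ρ := by linarith [hρ.1]
  have hq : 0 < 1 - ρ := by linarith [hρ.2]
  exact eqIntegral_diffDensity_gammaMixture (by positivity) (by positivity) (by positivity)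
    (by positivity) le_rfl hx (D₂_ne_zero hn hσX hσY hρ hμX hx)
    fun t ht => D₂_mul_integrand₂ hn hσX hσY hρ hμX hx ht

lemma eqIntegral_D₃ (hn : 1 ≤ n) (hσX : 0 < σX) (hσY : 0 < σY) (hρ : ρ ∈ Ioo (-1 : ℝ) 1)
    (hμX : μX ≠ 0) (hx : 0 < x) :
    EqIntegral (diffDensity
        (gammaMixture (n / 2) (1 / (σX * σY * (1 + ρ))) 0)
        (gammaMixture (n / 2) (1 / (σX * σY * (1 - ρ)))
          (n * ((2 * (|μX| / σX)) ^ 2 / (4 * (1 - ρ))))) x)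
      (D₃ n μX σX σY ρ x) (fun t => integrand₃ n μX σX σY ρ x t) := by
  have hN : (0 : ℝ) < n := by exact_mod_cast hn
  have hp : 0 < 1 + ρ := by linarith [hρ.1]
  have hq : 0 < 1 - ρ := by linarith [hρ.2]
  exact eqIntegral_diffDensity_gammaMixture (by positivity) (by positivity) (by positivity)
    le_rfl (by positivity) hx (D₃_ne_zero hn hσX hσY hρ hμX hx)
    fun t ht => D₃_mul_integrand₃ hn hσX hσY hρ hμX hx ht

lemma eqIntegralOrLimit_sumDensity₂ (hn : 1 ≤ n) (hσX : 0 < σX) (hσY : 0 < σY)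
    (hρ : ρ ∈ Ioo (-1 : ℝ) 1) (h : μX / σX = μY / σY) (hx : 0 < x) :
    EqIntegralOrLimit (sumDensity n μX μY σX σY ρ x) μX (fun m => D₂ n m σX σY ρ x)
      (fun m t => integrand₂ n m σX σY ρ x t) := by
  have hN : (0 : ℝ) < n := by exact_mod_cast hn
  have hp : 0 < 1 + ρ := by linarith [hρ.1]
  have hq : 0 < 1 - ρ := by linarith [hρ.2]
  refine ⟨fun hμ => ?_, ?_⟩
  · have e := eqIntegral_D₂ hn hσX hσY hρ hμ hx
    rw [sumDensity, ← h, sub_self, ← two_mul]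
    simpa [mul_pow, div_pow] using e
  · rintro rfl
    refine ⟨fun m hm => (eqIntegral_D₂ hn hσX hσY hρ hm hx).1, ?_⟩
    -- With `m` as the parameter, both standardised means are `m / σX`: their sum gives the Poisson
    -- parameter `κ₁ m²`, while their difference vanishes, so `κ₂ = 0`.
    have hlim := (tendsto_diffDensity_gammaMixture (α := n / 2) (r₁ := 1 / (σX * σY * (1 + ρ)))
      (r₂ := 1 / (σX * σY * (1 - ρ))) (κ₁ := n * ((2 / σX) ^ 2 / (4 * (1 + ρ)))) (κ₂ := 0)
      (by positivity) (by positivity) (by positivity) (by positivity) le_rfl hx).mono_left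
      (nhdsWithin_le_nhds (s := {0}ᶜ))
    rw [sumDensity, ← h]
    simp only [zero_div, sub_self, add_zero, ne_eq, OfNat.ofNat_ne_zero, not_false_eq_true,
      zero_pow, mul_zero]
    refine hlim.congr' ?_
    filter_upwards [self_mem_nhdsWithin] with m hm
    rw [← (eqIntegral_D₂ hn hσX hσY hρ hm hx).2, zero_mul, mul_pow 2, div_pow, div_pow, sq_abs]
    congr 2
    ring

lemma eqIntegralOrLimit_sumDensity₃ (hn : 1 ≤ n) (hσX : 0 < σX) (hσY : 0 < σY)
    (hρ : ρ ∈ Ioo (-1 : ℝ) 1) (h : μX / σX = -(μY / σY)) (hx : 0 < x) :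
    EqIntegralOrLimit (sumDensity n μX μY σX σY ρ x) μX (fun m => D₃ n m σX σY ρ x)
      (fun m t => integrand₃ n m σX σY ρ x t) := by
  have hN : (0 : ℝ) < n := by exact_mod_cast hn
  have hp : 0 < 1 + ρ := by linarith [hρ.1]
  have hq : 0 < 1 - ρ := by linarith [hρ.2]
  have h' : μY / σY = -(μX / σX) := by rw [h, neg_neg]
  refine ⟨fun hμ => ?_, ?_⟩
  · have e := eqIntegral_D₃ hn hσX hσY hρ hμ hx
    rw [sumDensity, h', sub_neg_eq_add, ← two_mul, add_neg_cancel]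
    simpa [mul_pow, div_pow] using e
  · rintro rfl
    refine ⟨fun m hm => (eqIntegral_D₃ hn hσX hσY hρ hm hx).1, ?_⟩
    -- Opposite standardised means: now the sum vanishes and the difference is `2m / σX`, so only
    -- the second mixture depends on `m`.
    have hlim := (tendsto_diffDensity_gammaMixture (α := n / 2) (r₁ := 1 / (σX * σY * (1 + ρ)))
      (r₂ := 1 / (σX * σY * (1 - ρ))) (κ₁ := 0) (κ₂ := n * ((2 / σX) ^ 2 / (4 * (1 - ρ))))
      (by positivity) (by positivity) (by positivity) le_rfl (by positivity) hx).mono_left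
      (nhdsWithin_le_nhds (s := {0}ᶜ))
    rw [sumDensity, h']
    simp only [zero_div, neg_zero, sub_self, add_zero, ne_eq, OfNat.ofNat_ne_zero,
      not_false_eq_true, zero_pow, mul_zero]
    refine hlim.congr' ?_
    filter_upwards [self_mem_nhdsWithin] with m hm
    rw [← (eqIntegral_D₃ hn hσX hσY hρ hm hx).2, zero_mul, mul_pow 2, div_pow, div_pow, sq_abs]
    congr 2
    ring

end ProductNormal

end

theorem theorem2p6 {Ω Ω' : Type*} [MeasurableSpace Ω] [MeasurableSpace Ω']
    (P : Measure Ω) [IsProbabilityMeasure P] (Q : Measure Ω') [IsProbabilityMeasure Q]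
    (μX μY σX σY ρ : ℝ) (hσX : 0 < σX) (hσY : 0 < σY) (hρ : ρ ∈ Set.Ioo (-1 : ℝ) 1)
    (X Y : Ω' → ℝ) (hXY : ProductNormal.IsBivariateNormal X Y μX μY σX σY ρ Q)
    (n : ℕ) (hn : 1 ≤ n) (Z : Fin n → Ω → ℝ) (hindep : iIndepFun Z P)
    (hZ : ∀ i, IdentDistrib (Z i) (fun ω => X ω * Y ω) P Q) :
    -- the sum has a density `f`, here its version that is continuous away from the origin
    ∃ f : ℝ → ℝ, Measurable f ∧ (∀ x, 0 ≤ f x) ∧ ContinuousOn f {0}ᶜ ∧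
      P.map (fun ω => ∑ i, Z i ω) = volume.withDensity (fun x => ENNReal.ofReal (f x)) ∧
      -- formulas for positive arguments
      (|μX| / σX ≠ |μY| / σY → ∀ x : ℝ, 0 < x →
        ProductNormal.EqIntegral (f x) (ProductNormal.D₁ n μX μY σX σY ρ x)
          (fun t => ProductNormal.integrand₁ n μX μY σX σY ρ x t)) ∧
      (μX / σX = μY / σY → ∀ x : ℝ, 0 < x →
        ProductNormal.EqIntegralOrLimit (f x) μX
          (fun m => ProductNormal.D₂ n m σX σY ρ x)
          (fun m t => ProductNormal.integrand₂ n m σX σY ρ x t)) ∧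
      (μX / σX = -(μY / σY) → ∀ x : ℝ, 0 < x →
        ProductNormal.EqIntegralOrLimit (f x) μX
          (fun m => ProductNormal.D₃ n m σX σY ρ x)
          (fun m t => ProductNormal.integrand₃ n m σX σY ρ x t)) ∧
      -- formulas for negative arguments: `(x, ρ, μY)` is replaced by `(-x, -ρ, -μY)`
      (|μX| / σX ≠ |-μY| / σY → ∀ x : ℝ, x < 0 →
        ProductNormal.EqIntegral (f x) (ProductNormal.D₁ n μX (-μY) σX σY (-ρ) (-x))
          (fun t => ProductNormal.integrand₁ n μX (-μY) σX σY (-ρ) (-x) t)) ∧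
      (μX / σX = -μY / σY → ∀ x : ℝ, x < 0 →
        ProductNormal.EqIntegralOrLimit (f x) μX
          (fun m => ProductNormal.D₂ n m σX σY (-ρ) (-x))
          (fun m t => ProductNormal.integrand₂ n m σX σY (-ρ) (-x) t)) ∧
      (μX / σX = -(-μY / σY) → ∀ x : ℝ, x < 0 →
        ProductNormal.EqIntegralOrLimit (f x) μX
          (fun m => ProductNormal.D₃ n m σX σY (-ρ) (-x))
          (fun m t => ProductNormal.integrand₃ n m σX σY (-ρ) (-x) t)) := by
  have hN : (0 : ℝ) < n := by exact_mod_cast hn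
  have hp : 0 < 1 + ρ := by linarith [hρ.1]
  have hq : 0 < 1 - ρ := by linarith [hρ.2]
  have hρ' : -ρ ∈ Set.Ioo (-1 : ℝ) 1 := ⟨by linarith [hρ.2], by linarith [hρ.1]⟩
  have hα : (0 : ℝ) < n / 2 := by positivity
  have hr₁ : 0 < 1 / (σX * σY * (1 + ρ)) := by positivity
  have hr₂ : 0 < 1 / (σX * σY * (1 - ρ)) := by positivity
  have hκ₁ : 0 ≤ n * ((μX / σX + μY / σY) ^ 2 / (4 * (1 + ρ))) := by positivity
  have hκ₂ : 0 ≤ n * ((μX / σX - μY / σY) ^ 2 / (4 * (1 - ρ))) := by positivity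
  have hg₁ := ProductNormal.gammaMixture_nonneg hα hr₁ hκ₁
  have hg₂ := ProductNormal.gammaMixture_nonneg hα hr₂ hκ₂
  have hm₁ := ProductNormal.measurable_gammaMixture (r := 1 / (σX * σY * (1 + ρ)))
    (κ := n * ((μX / σX + μY / σY) ^ 2 / (4 * (1 + ρ)))) hα
  have hm₂ := ProductNormal.measurable_gammaMixture (r := 1 / (σX * σY * (1 - ρ)))
    (κ := n * ((μX / σX - μY / σY) ^ 2 / (4 * (1 - ρ)))) hα
  refine ⟨ProductNormal.sumDensity n μX μY σX σY ρ, ProductNormal.measurable_diffDensity hm₁ hm₂,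
    fun x => integral_nonneg fun y => mul_nonneg (hg₁ _) (hg₂ _),
    ProductNormal.continuousOn_diffDensity_gammaMixture hα hr₁ hr₂ hκ₁ hκ₂, ?_,
    fun h x hx => ProductNormal.eqIntegral_sumDensity₁ hn hσX hσY hρ h hx,
    fun h x hx => ProductNormal.eqIntegralOrLimit_sumDensity₂ hn hσX hσY hρ h hx,
    fun h x hx => ProductNormal.eqIntegralOrLimit_sumDensity₃ hn hσX hσY hρ h hx,
    fun h x hx => ?_, fun h x hx => ?_, fun h x hx => ?_⟩
  · rw [ProductNormal.map_sum_eq_withDensity P Q hσX hσY hρ hXY hn hindep hZ rfl rfl rfl rfl]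
    exact ProductNormal.conv_withDensity_eq_diffDensity hm₁ hm₂ hg₁ hg₂ fun x hx =>
      ProductNormal.integrable_gammaMixture_mul_sub hα hr₁ hr₂ hκ₁ hκ₂ hx
  · rw [ProductNormal.sumDensity_eq_neg]
    exact ProductNormal.eqIntegral_sumDensity₁ hn hσX hσY hρ' h (neg_pos.2 hx)
  · rw [ProductNormal.sumDensity_eq_neg]
    exact ProductNormal.eqIntegralOrLimit_sumDensity₂ hn hσX hσY hρ' h (neg_pos.2 hx)
  · rw [ProductNormal.sumDensity_eq_neg]
    exact ProductNormal.eqIntegralOrLimit_sumDensity₃ hn hσX hσY hρ' h (neg_pos.2 hx)
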